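/- \textbf{Trees.} A ranked alphabet is a nonempty finite set of symbols, each with a rank in $\mathbb N$. For a ranked alphabet $\Sigma$ and a set $S$ disjoint from $\Sigma$, $T_\Sigma(S)$ is the set of trees over $\Sigma$ with additional leaf labels from $S$, $T_\Sigma=T_\Sigma(\emptyset)$, and $\Sigma(S)$ is the set of trees $\sigma(s_1,\dots,s_k)$ with $\sigma\in\Sigma$ of rank $k$ and $s_1,\dots,s_k\in S$. Positions of a tree are words over $\mathbb N$; $\varepsilon$ is the root. For $t\in T_\Sigma(S)$, $\mathrm{var}(t)$ is the set of elements of $S$ occurring in $t$; $t$ is linear in $S$ if each element of $S$ occurs at most once in $t$; $t[u]_w$ is $t$ with the subtree at position $w$ replaced by $u$. A tree language $L\subseteq T_\Sigma$ is regular if it is recognized by a finite (bottom-up) tree automaton. \textbf{Transducers.} A linear extended top-down tree transducer with regular look-ahead (l-xt$^{\mathrm R}$) is a tuple $M=(Q,\Sigma,\Delta,I,R,c)$ with a finite set $Q$ of states, ranked alphabets $\Sigma$ and $\Delta$, initial states $I\subseteq Q$, a finite set $R\subseteq T_\Sigma(Q)\times Q\times T_\Delta(Q)$ of rules $(\ell,q,r)$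 such that $\ell$ and $r$ are linear in $Q$ and $\mathrm{var}(r)\subseteq\mathrm{var}(\ell)$, and a regular tree language $c(q)\subseteq T_\Sigma$ for every $q\in Q$. A derivation works on triples $\langle\xi,D,\zeta\rangle$ of an input tree $\xi\in T_\Sigma(Q)$, an output tree $\zeta\in T_\Delta(Q)$, and a set $D$ of links, i.e. of pairs of a position of $\xi$ and a position of $\zeta$. There are two kinds of steps: (i) if $(\ell,q,r)\in R$, $(v,w)\in D$, and $\xi$ and $\zeta$ are labelled $q$ at $v$ and $w$, respectively, then $\langle\xi,D,\zeta\rangle\Rightarrow_M\langle\xi[\ell]_v,D\cup D',\zeta[r]_w\rangle$, where $D'$ consists of the pairs $(vx_p,wy_p)$, $p\in\mathrm{var}(r)$, with $x_p$ and $y_p$ the positions of $p$ in $\ell$ and $r$; (ii) if $\xi$ is labelled by a state $q$ at $v$, there is no $(v,w)\in D$ such that $\zeta$ is labelled by a state at $w$, and $t\in c(q)$, then $\langle\xi,D,\zeta\rangle\Rightarrow_M\langle\xi[t]_v,D,\zeta\rangle$. The tree transformation computed by $M$ is the set of all $(t,u)\in T_\Sigma\times T_\Delta$ such that $\langle q,\{(\varepsilon,\varepsilon)\},q\rangle\Rightarrow_M^*\langle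 t,D,u\rangle$ for some $q\in I$ and some $D$. \textbf{Properties.} $M$ is without look-ahead (an l-xt) if $c(q)=T_\Sigma$ for all $q\in Q$. It is a linear top-down tree transducer with regular look-ahead (l-t$^{\mathrm R}$) if $\ell\in\Sigma(Q)$ for all rules $(\ell,q,r)$; $\varepsilon$-free ($\not\varepsilon$) if $\ell\notin Q$ for all rules; strict (s) if $r\notin Q$ for all rules; delabeling (d) if $\ell\in\Sigma(Q)$ and $r\in Q\cup\Delta(Q)$ for all rules; nondeleting (n) if $\mathrm{var}(r)=\mathrm{var}(\ell)$ for all rules. A name in capital letters, such as $\not\varepsilon\text{snl-XT}$, denotes the class of all tree transformations computed by the transducers of that type. For relations, $R_1\,;R_2=\{(s,u)\mid\exists t\colon (s,t)\in R_1,\ (t,u)\in R_2\}$, and for classes of relations, $\mathcal C_1\,;\mathcal C_2=\{R_1\,;R_2\mid R_1\in\mathcal C_1,\ R_2\in\mathcal C_2\}$. \textbf{Lemma (decomposition).} \[ \not\varepsilon\text{l-XT}^{\mathrm R}\subseteq\text{dl-T}^{\mathrm R}\,;\,\not\varepsilon\text{snl-XT}\qquad\text{and}\qquad \not\varepsilon\text{sl-XT}^{\mathrm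 R}\subseteq\text{sdl-T}^{\mathrm R}\,;\,\not\varepsilon\text{snl-XT}. \] -/

import Mathlib

universe u

namespace XTop

/-! ### Ranked alphabets and trees -/

/-- A ranked alphabet: a nonempty finite set of symbols, each with a rank. -/
structure RankedAlphabet where
  Symbol : Type u
  [finite : Finite Symbol]
  [nonempty : Nonempty Symbol]
  rk : Symbol → ℕ

/-- `RTree A S` is the set `T_A(S)` of trees over the ranked alphabet `A` with leaf labels `S`. -/
inductive RTree (A : RankedAlphabet.{u}) (S : Type u) : Type u
  | leaf (s : S) : RTree A S
  | node (a : A.Symbol) (ts : Fin (A.rk a) → RTree A S) : RTree A S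

/-- `T_A`: the trees over `A` without additional leaf labels. -/
abbrev GTree (A : RankedAlphabet.{u}) : Type u := RTree A PEmpty.{u + 1}

namespace RTree

variable {A : RankedAlphabet.{u}} {S : Type u}

/-- The inclusion of `T_A` in `T_A(S)`. -/
def ofGround : GTree A → RTree A S
  | leaf s => s.elim
  | node a ts => node a (fun i => ofGround (ts i))

/-- The `w`-rooted subtree of `t`, if the word `w` is a position of `t`;
children are numbered `1, …, k`. -/
def subtree? : RTree A S → List ℕ → Option (RTree A S)
  | t, [] => some t
  | leaf _, _ :: _ => none
  | node _ _, 0 :: _ => none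
  | node a ts, (i + 1) :: w => if h : i < A.rk a then subtree? (ts ⟨i, h⟩) w else none

/-- `pos(t)`. -/
def pos (t : RTree A S) : Set (List ℕ) := {w | (t.subtree? w).isSome}

/-- `pos_s(t)`: the positions of `t` labelled by `s ∈ S`. -/
def posLeaf (s : S) (t : RTree A S) : Set (List ℕ) := {w | t.subtree? w = some (leaf s)}

/-- `pos_S(t)`: the positions of `t` labelled by an element of `S`. -/
def posLeaves (t : RTree A S) : Set (List ℕ) := {w | ∃ s, w ∈ posLeaf s t}

/-- `var(t)`: the elements of `S` that occur in `t`. -/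
def var (t : RTree A S) : Set S := {s | (posLeaf s t).Nonempty}

/-- `t` is linear in `S`: every element of `S` occurs at most once. -/
def Linear (t : RTree A S) : Prop := ∀ s, (posLeaf s t).Subsingleton

/-- `t[u]_w`: replace the subtree of `t` at `w` by `u` (`t` is unchanged if `w ∉ pos(t)`). -/
def replaceAt : RTree A S → List ℕ → RTree A S → RTree A S
  | _, [], u => u
  | leaf s, _ :: _, _ => leaf s
  | node a ts, 0 :: _, _ => node a ts
  | node a ts, (i + 1) :: w, u =>
    if h : i < A.rk a then
      node a (Function.update ts ⟨i, h⟩ (replaceAt (ts ⟨i, h⟩) w u))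
    else node a ts

/-- `t ∈ S`. -/
def IsLeaf (t : RTree A S) : Prop := ∃ s, t = leaf s

/-- `t ∈ A(S)`: a symbol applied directly to elements of `S`. -/
def IsFlat (t : RTree A S) : Prop :=
  ∃ (a : A.Symbol) (s : Fin (A.rk a) → S), t = node a (fun i => leaf (s i))

end RTree

/-! ### Regular tree languages -/

/-- A (total deterministic bottom-up) finite tree automaton over `A`. -/
structure TreeAutomaton (A : RankedAlphabet.{u}) where
  State : Type u
  [finite : Finite State]
  step : (a : A.Symbol) → (Fin (A.rk a) → State) → State
  final : Set State

/-- The state reached by the automaton at the root of a tree. -/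
def TreeAutomaton.run {A : RankedAlphabet.{u}} (N : TreeAutomaton A) : GTree A → N.State
  | .leaf s => s.elim
  | .node a ts => N.step a (fun i => N.run (ts i))

/-- `L ∈ Reg(A)`. -/
def IsRegular {A : RankedAlphabet.{u}} (L : Set (GTree A)) : Prop :=
  ∃ N : TreeAutomaton A, L = {t | N.run t ∈ N.final}

/-! ### Linear extended top-down tree transducers with regular look-ahead -/

/-- A linear extended top-down tree transducer with regular look-ahead, with input alphabet `A`
and output alphabet `B`. A rule is a triple `(ℓ, q, r)`. -/
structure Transducer (A B : RankedAlphabet.{u}) where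
  State : Type u
  [finite : Finite State]
  initial : Set State
  rules : Set (RTree A State × State × RTree B State)
  rules_finite : rules.Finite
  linear_left : ∀ l q r, (l, q, r) ∈ rules → l.Linear
  linear_right : ∀ l q r, (l, q, r) ∈ rules → r.Linear
  var_subset : ∀ l q r, (l, q, r) ∈ rules → r.var ⊆ l.var
  lookahead : State → Set (GTree A)
  lookahead_regular : ∀ q, IsRegular (lookahead q)

/-- A triple `⟨ξ, D, ζ⟩` of an input tree, a set of links, and an output tree. -/
structure Form (A B : RankedAlphabet.{u}) (Q : Type u) where
  input : RTree A Q
  links : Set (List ℕ × List ℕ)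
  output : RTree B Q

/-- The triple is a sentential form: links connect positions of the two trees. -/
def Form.IsSentential {A B : RankedAlphabet.{u}} {Q : Type u} (F : Form A B Q) : Prop :=
  ∀ v w, (v, w) ∈ F.links → v ∈ F.input.pos ∧ w ∈ F.output.pos

/-- `link_{v,w}(ρ)` for a rule `ρ = (ℓ, q, r)`: equal states of `ℓ` and `r` are linked. -/
def ruleLinks {A B : RankedAlphabet.{u}} {Q : Type u} (v w : List ℕ)
    (l : RTree A Q) (r : RTree B Q) : Set (List ℕ × List ℕ) :=
  {d | ∃ p, ∃ x ∈ l.posLeaf p, ∃ y ∈ r.posLeaf p, d = (v ++ x, w ++ y)}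

namespace Transducer

variable {A B : RankedAlphabet.{u}}

/-- The derivation relation `⇒_M`. -/
inductive Step (M : Transducer A B) : Form A B M.State → Form A B M.State → Prop
  /-- apply a rule for `q` at a pair of linked occurrences of `q` -/
  | rule (ξ : RTree A M.State) (D : Set (List ℕ × List ℕ)) (ζ : RTree B M.State)
      (l : RTree A M.State) (q : M.State) (r : RTree B M.State) (v w : List ℕ) :
      (l, q, r) ∈ M.rules → (v, w) ∈ D → v ∈ ξ.posLeaf q → w ∈ ζ.posLeaf q →
      Step M ⟨ξ, D, ζ⟩ ⟨ξ.replaceAt v l, D ∪ ruleLinks v w l r, ζ.replaceAt w r⟩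
  /-- replace an input occurrence of `q` without active link by a tree of its look-ahead -/
  | look (ξ : RTree A M.State) (D : Set (List ℕ × List ℕ)) (ζ : RTree B M.State)
      (q : M.State) (v : List ℕ) (t : GTree A) :
      v ∈ ξ.posLeaf q → (∀ w, (v, w) ∈ D → w ∉ ζ.posLeaves) → t ∈ M.lookahead q →
      Step M ⟨ξ, D, ζ⟩ ⟨ξ.replaceAt v t.ofGround, D, ζ⟩

/-- `⟨q, {(ε, ε)}, q⟩`. -/
def start (M : Transducer A B) (q : M.State) : Form A B M.State :=
  ⟨.leaf q, {([], [])}, .leaf q⟩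

/-- The dependencies `dep(M)`. -/
def dep (M : Transducer A B) : Set (GTree A × Set (List ℕ × List ℕ) × GTree B) :=
  {d | ∃ q ∈ M.initial,
    Relation.ReflTransGen M.Step (M.start q) ⟨d.1.ofGround, d.2.1, d.2.2.ofGround⟩}

/-- The tree transformation computed by `M`. -/
def transformation (M : Transducer A B) : SetRel (GTree A) (GTree B) :=
  {p | ∃ D, (p.1, D, p.2) ∈ M.dep}

/-- No look-ahead: the look-ahead of every state is `T_A`. -/
def NoLookahead (M : Transducer A B) : Prop := ∀ q, M.lookahead q = Set.univ

/-- `M` is a (non-extended) linear top-down tree transducer with regular look-ahead. -/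
def TopDown (M : Transducer A B) : Prop := ∀ l q r, (l, q, r) ∈ M.rules → l.IsFlat

def EpsFree (M : Transducer A B) : Prop := ∀ l q r, (l, q, r) ∈ M.rules → ¬ l.IsLeaf

def Strict (M : Transducer A B) : Prop := ∀ l q r, (l, q, r) ∈ M.rules → ¬ r.IsLeaf

def Delabeling (M : Transducer A B) : Prop :=
  ∀ l q r, (l, q, r) ∈ M.rules → l.IsFlat ∧ (r.IsLeaf ∨ r.IsFlat)

def Nondeleting (M : Transducer A B) : Prop := ∀ l q r, (l, q, r) ∈ M.rules → r.var = l.var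

end Transducer

/-! ### Sentential forms are preserved by derivation steps -/

theorem RTree.pos_replaceAt {A : RankedAlphabet.{u}} {S : Type u} (t : RTree A S) (w x : List ℕ)
    (s : S) (u : RTree A S) (hw : w ∈ t.posLeaf s) (hx : x ∈ t.pos) :
    x ∈ (t.replaceAt w u).pos := by
  induction w generalizing t x with
  | nil =>
    have ht : t = .leaf s := by simpa [posLeaf, subtree?] using hw
    subst ht
    cases x with
    | nil => simp [pos, subtree?]
    | cons j x => simp [pos, subtree?] at hx
  | cons i w ih =>
    cases t with
    | leaf s' => simpa [replaceAt] using hx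
    | node a ts =>
      rcases i with _ | i
      · simpa [replaceAt] using hx
      · by_cases hi : i < A.rk a
        · simp only [posLeaf, Set.mem_ofPred_eq, subtree?, dif_pos hi] at hw
          simp only [replaceAt, dif_pos hi]
          rcases x with _ | ⟨_ | j, x⟩
          · simp [pos, subtree?]
          · simp [pos, subtree?] at hx
          · by_cases hj : j < A.rk a
            · simp only [pos, Set.mem_ofPred_eq, subtree?, dif_pos hj] at hx ⊢
              by_cases hij : j = i
              · subst hij
                simp only [Function.update_self]
                exact ih (ts ⟨j, hj⟩) x hw hx
              · rw [Function.update_of_ne (by simpa using hij)]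
                exact hx
            · simp [pos, subtree?, hj] at hx
        · simpa [replaceAt, hi] using hx

theorem RTree.append_mem_pos_replaceAt {A : RankedAlphabet.{u}} {S : Type u} (t : RTree A S)
    (w x : List ℕ) (u : RTree A S) (hw : w ∈ t.pos) (hx : x ∈ u.pos) :
    w ++ x ∈ (t.replaceAt w u).pos := by
  induction w generalizing t with
  | nil => simpa [replaceAt] using hx
  | cons i w ih =>
    cases t with
    | leaf s' => simp [pos, subtree?] at hw
    | node a ts =>
      rcases i with _ | i
      · simp [pos, subtree?] at hw
      · by_cases hi : i < A.rk a
        · simp only [pos, Set.mem_ofPred_eq, subtree?, dif_pos hi] at hw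
          simpa [pos, replaceAt, hi, subtree?] using ih (ts ⟨i, hi⟩) hw
        · simp [pos, subtree?, hi] at hw

theorem RTree.posLeaf_subset_pos {A : RankedAlphabet.{u}} {S : Type u} (t : RTree A S) (s : S) :
    t.posLeaf s ⊆ t.pos := by
  intro w hw
  have hw' : t.subtree? w = some (.leaf s) := hw
  simp [pos, hw']

theorem Transducer.isSentential_start {A B : RankedAlphabet.{u}} (M : Transducer A B)
    (q : M.State) : (M.start q).IsSentential := by
  intro v w h
  obtain ⟨rfl, rfl⟩ : v = [] ∧ w = [] := by simpa [start] using h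
  simp [start, RTree.pos, RTree.subtree?]

/-- Every triple derivable from a sentential form is again a sentential form, so the definition
of `Step` on arbitrary triples agrees with its restriction to sentential forms. -/
theorem Transducer.Step.isSentential {A B : RankedAlphabet.{u}} {M : Transducer A B}
    {F G : Form A B M.State} (h : M.Step F G) (hF : F.IsSentential) : G.IsSentential := by
  cases h with
  | rule ξ D ζ l q r v w _ hD hv hw =>
    rintro x y (hxy | ⟨p, x', hx', y', hy', he⟩)
    · obtain ⟨h1, h2⟩ := hF x y hxy
      exact ⟨RTree.pos_replaceAt _ _ _ _ _ hv h1, RTree.pos_replaceAt _ _ _ _ _ hw h2⟩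
    · obtain ⟨rfl, rfl⟩ := Prod.mk.inj he
      exact ⟨RTree.append_mem_pos_replaceAt _ _ _ _ (RTree.posLeaf_subset_pos _ _ hv)
          (RTree.posLeaf_subset_pos _ _ hx'),
        RTree.append_mem_pos_replaceAt _ _ _ _ (RTree.posLeaf_subset_pos _ _ hw)
          (RTree.posLeaf_subset_pos _ _ hy')⟩
  | look ξ D ζ q v t hv hD ht =>
    intro x y hxy
    obtain ⟨h1, h2⟩ := hF x y hxy
    exact ⟨RTree.pos_replaceAt _ _ _ _ _ hv h1, h2⟩

/-! ### Classes of tree transformations -/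

/-- A class of tree transformations, indexed by input and output alphabet. -/
abbrev TransClass : Type (u + 1) :=
  (A B : RankedAlphabet.{u}) → Set (SetRel (GTree A) (GTree B))

/-- `𝒞₁ ; 𝒞₂`: first a relation of `𝒞₁`, then a relation of `𝒞₂`. -/
def TransClass.seq (C₁ C₂ : TransClass.{u}) : TransClass.{u} := fun A B =>
  {τ | ∃ (G : RankedAlphabet.{u}), ∃ τ₁ ∈ C₁ A G, ∃ τ₂ ∈ C₂ G B, τ = τ₁.comp τ₂}

/-- The transformations computed by ε-free linear extended top-down tree transducers with
regular look-ahead. -/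
def efreeLXTR : TransClass.{u} := fun A B =>
  {τ | ∃ M : Transducer A B, M.EpsFree ∧ M.transformation = τ}

/-- As `efreeLXTR`, with strict transducers. -/
def efreeStrictLXTR : TransClass.{u} := fun A B =>
  {τ | ∃ M : Transducer A B, M.EpsFree ∧ M.Strict ∧ M.transformation = τ}

/-- The transformations computed by delabeling linear top-down tree transducers with regular
look-ahead. -/
def delabelingLTR : TransClass.{u} := fun A B =>
  {τ | ∃ M : Transducer A B, M.TopDown ∧ M.Delabeling ∧ M.transformation = τ}

/-- As `delabelingLTR`, with strict transducers. -/
def strictDelabelingLTR : TransClass.{u} := fun A B =>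
  {τ | ∃ M : Transducer A B, M.TopDown ∧ M.Strict ∧ M.Delabeling ∧ M.transformation = τ}

/-- The transformations computed by ε-free, strict, nondeleting linear extended top-down tree
transducers (without look-ahead). -/
def efreeStrictNondeletingLXT : TransClass.{u} := fun A B =>
  {τ | ∃ M : Transducer A B, M.NoLookahead ∧ M.EpsFree ∧ M.Strict ∧ M.Nondeleting ∧
    M.transformation = τ}

end XTop

namespace XTop
-- Leaf positions and replacement
namespace RTree

variable {A : RankedAlphabet.{u}} {S T : Type u}

/-! An ε-free transducer `M` factors as `front` followed by `back`. On entering an application of a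
rule `ρ = (ℓ, q, r)`, `front` guesses `ρ` and then reads `ℓ` node by node; its state records `ρ` and
the subterm of `ℓ` still to be matched. A subterm of `ℓ` containing no state of `r` is deleted, and
look-ahead checks that the deleted input matches it, including the look-ahead of `M` at the states
inside; such a language is regular (`isRegular_matches`). The other nodes are kept, restricted to
their kept children, and the root of the application is tagged with `ρ`. If `r` is a single state,
`front` instead erases all of `ℓ` down to that state and leaves no trace, so it is strict when `M`
is.

What remains of `ℓ` when `r` is not a state is a non-leaf pattern with exactly the states of `r`
(`var_output_lhs`). Thus `back`, which replaces tagged patterns by right-hand sides, is ε-free,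
strict and nondeleting, and it needs no look-ahead. The tag reveals the rule, and `back` ignores its
own state because `front` has already checked the states of `M`.

Derivations with links are awkward to compose, so everything is carried out in an inductive big-step
semantics `Big`, equivalent to derivations for ε-free transducers (`mem_transformation_iff`). The
inclusion of `M` in the composition is an induction on `Big` (`Big.exists_decomposition`); the
converse is an induction on the size of the input (`Big.of_decomposition`), which shrinks because
every `ℓ` contains a symbol. -/

@[simp] theorem mem_posLeaf_leaf {s s' : S} {w : List ℕ} :
    w ∈ posLeaf s (leaf s' : RTree A S) ↔ w = [] ∧ s' = s := by
  cases w <;> simp [posLeaf, subtree?]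

@[simp] theorem mem_posLeaf_node {s : S} {a : A.Symbol} {ts : Fin (A.rk a) → RTree A S}
    {w : List ℕ} :
    w ∈ posLeaf s (node a ts) ↔ ∃ (i : Fin (A.rk a)) (x : List ℕ),
      w = ((i : ℕ) + 1) :: x ∧ x ∈ posLeaf s (ts i) := by
  rcases w with _ | ⟨_ | j, w⟩
  · simp [posLeaf, subtree?]
  · simp [posLeaf, subtree?]
  · by_cases h : j < A.rk a
    · simp only [posLeaf, Set.mem_ofPred_eq, subtree?, dif_pos h]
      constructor
      · intro hw
        exact ⟨⟨j, h⟩, w, rfl, hw⟩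
      · rintro ⟨i, x, he, hx⟩
        simp only [List.cons.injEq, Nat.add_right_cancel_iff] at he
        obtain ⟨rfl, rfl⟩ := he
        exact hx
    · simp only [posLeaf, Set.mem_ofPred_eq, subtree?, dif_neg h, reduceCtorEq, false_iff]
      rintro ⟨i, x, he, hx⟩
      simp only [List.cons.injEq, Nat.add_right_cancel_iff] at he
      exact h (he.1 ▸ i.2)

theorem mem_posLeaves {t : RTree A S} {w : List ℕ} :
    w ∈ t.posLeaves ↔ ∃ s, w ∈ t.posLeaf s := Iff.rfl

theorem mem_var {t : RTree A S} {s : S} : s ∈ t.var ↔ ∃ w, w ∈ t.posLeaf s := Iff.rfl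

@[simp] theorem mem_var_leaf {s s' : S} : s' ∈ (leaf s : RTree A S).var ↔ s = s' := by
  simp [mem_var]

@[simp] theorem mem_var_node {s : S} {a : A.Symbol} {ts : Fin (A.rk a) → RTree A S} :
    s ∈ (node a ts).var ↔ ∃ i, s ∈ (ts i).var := by
  simp only [mem_var, mem_posLeaf_node]
  constructor
  · rintro ⟨_, i, x, rfl, hx⟩
    exact ⟨i, x, hx⟩
  · rintro ⟨i, x, hx⟩
    exact ⟨_, i, x, rfl, hx⟩

theorem posLeaf_unique {t : RTree A S} {s s' : S} {w : List ℕ} (h : w ∈ t.posLeaf s)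
    (h' : w ∈ t.posLeaf s') : s = s' := by
  have h₁ : t.subtree? w = some (leaf s) := h
  have h₂ : t.subtree? w = some (leaf s') := h'
  rw [h₁] at h₂
  simpa using h₂

theorem linear_leaf (s : S) : (leaf s : RTree A S).Linear := by
  intro s' x hx y hy
  simp only [mem_posLeaf_leaf] at hx hy
  rw [hx.1, hy.1]

theorem linear_node {a : A.Symbol} {ts : Fin (A.rk a) → RTree A S} :
    (node a ts).Linear ↔ (∀ i, (ts i).Linear) ∧
      ∀ i j s, s ∈ (ts i).var → s ∈ (ts j).var → i = j := by
  constructor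
  · intro h
    refine ⟨fun i s x hx y hy => ?_, ?_⟩
    · have := h s (mem_posLeaf_node.2 ⟨i, x, rfl, hx⟩) (mem_posLeaf_node.2 ⟨i, y, rfl, hy⟩)
      simpa using this
    · rintro i j s ⟨x, hx⟩ ⟨y, hy⟩
      have := h s (mem_posLeaf_node.2 ⟨i, x, rfl, hx⟩) (mem_posLeaf_node.2 ⟨j, y, rfl, hy⟩)
      simp only [List.cons.injEq, Nat.add_right_cancel_iff] at this
      exact Fin.ext this.1
  · rintro ⟨h₁, h₂⟩ s x hx y hy
    obtain ⟨i, x, rfl, hx'⟩ := mem_posLeaf_node.1 hx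
    obtain ⟨j, y, rfl, hy'⟩ := mem_posLeaf_node.1 hy
    obtain rfl := h₂ i j s ⟨x, hx'⟩ ⟨y, hy'⟩
    rw [h₁ i s hx' hy']

-- In a linear tree a label has at most one position, so data indexed by leaf positions factor
-- through labels. This turns `fill` into `subst` for the sides of a rule.
open Classical in
theorem Linear.exists_labelling {X : Type*} {t : RTree A S} (ht : t.Linear) (γ : List ℕ → X) :
    ∃ θ : S → X, ∀ s, ∀ w ∈ t.posLeaf s, γ w = θ s := by
  refine ⟨fun s => if h : ∃ w, w ∈ t.posLeaf s then γ h.choose else γ [], fun s w hw => ?_⟩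
  have h : ∃ w, w ∈ t.posLeaf s := ⟨w, hw⟩
  simp only [dif_pos h]
  rw [ht s h.choose_spec hw]

/-- A leaf position has no proper extension among the positions of a tree. -/
theorem eq_nil_of_append_mem_pos {t : RTree A S} {s : S} {v y : List ℕ} (hv : v ∈ t.posLeaf s)
    (h : v ++ y ∈ t.pos) : y = [] := by
  induction v generalizing t with
  | nil =>
    have ht : t = .leaf s := by simpa [posLeaf, subtree?] using hv
    subst ht
    cases y with
    | nil => rfl
    | cons j y => simp [pos, subtree?] at h
  | cons i v ih =>
    cases t with
    | leaf s' => simp at hv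
    | node a ts =>
      obtain ⟨j, x, he, hx⟩ := mem_posLeaf_node.1 hv
      simp only [List.cons.injEq] at he
      obtain ⟨rfl, rfl⟩ := he
      refine ih hx ?_
      simpa [pos, subtree?] using h

theorem posLeaves_subset_pos (t : RTree A S) : t.posLeaves ⊆ t.pos := by
  rintro w ⟨s, hs⟩
  exact posLeaf_subset_pos t s hs

theorem ne_append_of_mem_posLeaves {t : RTree A S} {s : S} {v x y : List ℕ}
    (hv : v ∈ t.posLeaf s) (hx : x ∈ t.pos) (hne : x ≠ v) : x ≠ v ++ y := by
  rintro rfl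
  exact hne (by rw [eq_nil_of_append_mem_pos hv hx, List.append_nil])

/-- Nothing lies below a leaf, so `x ≠ v` alone says that an old leaf `x` is outside the replaced
part. -/
theorem mem_posLeaf_replaceAt {t u : RTree A S} {q p : S} {v x : List ℕ}
    (hv : v ∈ t.posLeaf q) :
    x ∈ (t.replaceAt v u).posLeaf p ↔
      (∃ y, x = v ++ y ∧ y ∈ u.posLeaf p) ∨ (x ≠ v ∧ x ∈ t.posLeaf p) := by
  induction v generalizing t x with
  | nil =>
    have ht : t = .leaf q := by simpa [posLeaf, subtree?] using hv
    subst ht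
    simp +contextual [replaceAt]
  | cons i v ih =>
    cases t with
    | leaf s' => simp at hv
    | node a ts =>
      obtain ⟨j, x', he, hx'⟩ := mem_posLeaf_node.1 hv
      simp only [List.cons.injEq] at he
      obtain ⟨rfl, rfl⟩ := he
      simp only [replaceAt, Fin.is_lt, dif_pos, Fin.eta, mem_posLeaf_node]
      constructor
      · rintro ⟨k, z, rfl, hz⟩
        by_cases hk : k = j
        · subst hk
          rw [Function.update_self, ih hx'] at hz
          rcases hz with ⟨y, rfl, hy⟩ | ⟨hne, hz⟩
          · exact Or.inl ⟨y, rfl, hy⟩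
          · exact Or.inr ⟨by simpa using hne, k, z, rfl, hz⟩
        · rw [Function.update_of_ne hk] at hz
          refine Or.inr ⟨?_, k, z, rfl, hz⟩
          intro h
          simp only [List.cons.injEq, Nat.add_right_cancel_iff] at h
          exact hk (Fin.ext h.1)
      · rintro (⟨y, rfl, hy⟩ | ⟨hne, k, z, rfl, hz⟩)
        · refine ⟨j, v ++ y, rfl, ?_⟩
          rw [Function.update_self, ih hx']
          exact Or.inl ⟨y, rfl, hy⟩
        · refine ⟨k, z, rfl, ?_⟩
          by_cases hk : k = j
          · subst hk
            rw [Function.update_self, ih hx']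
            exact Or.inr ⟨by simpa using hne, hz⟩
          · rwa [Function.update_of_ne hk]

/-! ### Substitution by labels, filling by positions, and size -/

/-- Replace every leaf label by a tree. -/
def subst : RTree A S → (S → RTree A T) → RTree A T
  | leaf s, f => f s
  | node a ts, f => node a (fun i => (ts i).subst f)

/-- Replace the leaf at each position `w` by the tree `α w`. -/
def fill : RTree A S → (List ℕ → RTree A T) → RTree A T
  | leaf _, α => α []
  | node a ts, α => node a (fun i => (ts i).fill (fun w => α (((i : ℕ) + 1) :: w)))

/-- The number of inner nodes. -/
def size : RTree A S → ℕ
  | leaf _ => 0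
  | node _ ts => 1 + ∑ i, (ts i).size

theorem subst_congr {t : RTree A S} {f g : S → RTree A T} (h : ∀ s ∈ t.var, f s = g s) :
    t.subst f = t.subst g := by
  induction t with
  | leaf s => exact h s (by simp)
  | node a ts ih =>
    simp only [subst]
    congr 1
    funext i
    exact ih i fun s hs => h s (mem_var_node.2 ⟨i, hs⟩)

theorem eqOn_var_of_subst_eq {t : RTree A S} {f g : S → RTree A T}
    (h : t.subst f = t.subst g) : ∀ s ∈ t.var, f s = g s := by
  induction t with
  | leaf s => simpa [subst] using h
  | node a ts ih =>
    intro s hs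
    obtain ⟨i, hi⟩ := mem_var_node.1 hs
    simp only [subst, node.injEq, heq_eq_eq, true_and] at h
    exact ih i (congrFun h i) s hi

theorem fill_congr {t : RTree A S} {α β : List ℕ → RTree A T}
    (h : ∀ w ∈ t.posLeaves, α w = β w) : t.fill α = t.fill β := by
  induction t generalizing α β with
  | leaf s => exact h [] ⟨s, by simp⟩
  | node a ts ih =>
    simp only [fill]
    congr 1
    funext i
    refine ih i fun w hw => h _ ?_
    obtain ⟨s, hs⟩ := hw
    exact ⟨s, mem_posLeaf_node.2 ⟨i, w, rfl, hs⟩⟩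

theorem fill_eq_subst {t : RTree A S} {α : List ℕ → RTree A T} {f : S → RTree A T}
    (h : ∀ s, ∀ w ∈ t.posLeaf s, α w = f s) : t.fill α = t.subst f := by
  induction t generalizing α with
  | leaf s => exact h s [] (by simp)
  | node a ts ih =>
    simp only [fill, subst]
    congr 1
    funext i
    exact ih i fun s w hw => h s _ (mem_posLeaf_node.2 ⟨i, w, rfl, hw⟩)

/-- Grafting and then filling is filling with one changed value at `v`; this carries a completion of
a form back across a derivation step. -/
theorem fill_replaceAt {t u : RTree A S} {q : S} {v : List ℕ} {α : List ℕ → RTree A T}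
    (hv : v ∈ t.posLeaf q) :
    (t.replaceAt v u).fill α =
      t.fill (Function.update α v (u.fill fun x => α (v ++ x))) := by
  induction v generalizing t α with
  | nil =>
    have ht : t = .leaf q := by simpa [posLeaf, subtree?] using hv
    subst ht
    simp [replaceAt, fill]
  | cons i v ih =>
    cases t with
    | leaf s' => simp at hv
    | node a ts =>
      obtain ⟨j, x', he, hx'⟩ := mem_posLeaf_node.1 hv
      simp only [List.cons.injEq] at he
      obtain ⟨rfl, rfl⟩ := he
      simp only [replaceAt, Fin.is_lt, dif_pos, Fin.eta, fill]
      congr 1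
      funext k
      by_cases hk : k = j
      · subst hk
        rw [Function.update_self, ih hx']
        congr 1
        funext w
        by_cases hw : w = v
        · subst hw
          simp
        · rw [Function.update_of_ne hw, Function.update_of_ne (by simpa using hw)]
      · rw [Function.update_of_ne hk]
        congr 1
        funext w
        rw [Function.update_of_ne]
        intro h
        simp only [List.cons.injEq, Nat.add_right_cancel_iff] at h
        exact hk (Fin.ext h.1)

theorem posLeaf_ofGround (t : GTree A) (s : S) (w : List ℕ) :
    w ∉ (ofGround t : RTree A S).posLeaf s := by
  induction t generalizing w with
  | leaf s => exact s.elim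
  | node a ts ih =>
    simp only [ofGround, mem_posLeaf_node]
    rintro ⟨i, x, -, hx⟩
    exact ih i x hx

theorem fill_ofGround (t : GTree A) (α : List ℕ → GTree A) :
    (ofGround t : RTree A S).fill α = t := by
  induction t generalizing α with
  | leaf s => exact s.elim
  | node a ts ih =>
    simp only [ofGround, fill]
    congr 1
    funext i
    exact ih i _

theorem ofGround_fill {t : RTree A S} {α : List ℕ → GTree A} (h : ∀ w, w ∉ t.posLeaves) :
    ofGround (t.fill α) = t := by
  induction t generalizing α with
  | leaf s => exact (h [] ⟨s, by simp⟩).elim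
  | node a ts ih =>
    simp only [ofGround, fill]
    congr 1
    funext i
    refine ih i fun w hw => ?_
    obtain ⟨s, hs⟩ := hw
    exact h _ ⟨s, mem_posLeaf_node.2 ⟨i, w, rfl, hs⟩⟩

theorem size_le_size_fill (t : RTree A S) (α : List ℕ → RTree A T) :
    t.size ≤ (t.fill α).size := by
  induction t generalizing α with
  | leaf s => simp [size]
  | node a ts ih =>
    simp only [size, fill]
    exact Nat.add_le_add_left (Finset.sum_le_sum fun i _ => ih i _) 1

theorem size_replaceAt {t u : RTree A S} {q : S} {v : List ℕ} (hv : v ∈ t.posLeaf q) :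
    (t.replaceAt v u).size = t.size + u.size := by
  induction v generalizing t with
  | nil =>
    have ht : t = .leaf q := by simpa [posLeaf, subtree?] using hv
    subst ht
    simp [replaceAt, size]
  | cons i v ih =>
    cases t with
    | leaf s' => simp at hv
    | node a ts =>
      obtain ⟨j, x', he, hx'⟩ := mem_posLeaf_node.1 hv
      simp only [List.cons.injEq] at he
      obtain ⟨rfl, rfl⟩ := he
      simp only [replaceAt, Fin.is_lt, dif_pos, Fin.eta, size]
      rw [← Finset.add_sum_erase _ _ (Finset.mem_univ j),
        ← Finset.add_sum_erase _ (fun i => (ts i).size) (Finset.mem_univ j),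
        Function.update_self, ih hx',
        Finset.sum_congr rfl fun k hk => by rw [Function.update_of_ne (Finset.ne_of_mem_erase hk)]]
      omega

theorem size_pos_of_not_isLeaf {t : RTree A S} (h : ¬ t.IsLeaf) : 0 < t.size := by
  cases t with
  | leaf s => exact (h ⟨s, rfl⟩).elim
  | node a ts => simp [size]

theorem size_pos_of_ground (t : GTree A) : 0 < t.size := by
  cases t with
  | leaf s => exact s.elim
  | node a ts => simp [size]

theorem size_ofGround (t : GTree A) : (ofGround t : RTree A S).size = t.size := by
  induction t with
  | leaf s => exact s.elim
  | node a ts ih => simp [size, ofGround, ih]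

theorem size_le_size_subst {t : RTree A S} {s : S} (hs : s ∈ t.var) (f : S → RTree A T) :
    t.size + (f s).size ≤ (t.subst f).size := by
  induction t with
  | leaf s' => simp_all [size, subst]
  | node a ts ih =>
    obtain ⟨i, hi⟩ := mem_var_node.1 hs
    simp only [size, subst]
    rw [← Finset.add_sum_erase _ _ (Finset.mem_univ i),
      ← Finset.add_sum_erase _ (fun i => ((ts i).subst f).size) (Finset.mem_univ i)]
    have h₁ := ih i hi
    have h₂ : ∑ k ∈ Finset.univ.erase i, (ts k).size ≤
        ∑ k ∈ Finset.univ.erase i, ((ts k).subst f).size := by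
      refine Finset.sum_le_sum fun k _ => ?_
      -- The siblings need not contain `s`, so the induction hypothesis does not apply; that
      -- substitution never shrinks a tree is proved separately.
      clear h₁ ih hs hi
      generalize ts k = t
      induction t with
      | leaf s => simp [size]
      | node a ts ih =>
        simp only [size, subst]
        exact Nat.add_le_add_left (Finset.sum_le_sum fun i _ => ih i) 1
    omega

end RTree
end XTop

/-! ### Equivalence of derivations and big-step semantics -/

namespace XTop
namespace Transducer
open RTree

variable {A B : RankedAlphabet.{u}}

/-- The big-step semantics: `M.Big q t u` if `M` translates `t` to `u` starting in state `q`. -/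
inductive Big (M : Transducer A B) : M.State → GTree A → GTree B → Prop
  | mk (l : RTree A M.State) (q : M.State) (r : RTree B M.State) (θ : M.State → GTree A)
      (η : M.State → GTree B) :
      (l, q, r) ∈ M.rules → (∀ p ∈ r.var, Big M p (θ p) (η p)) →
      (∀ p ∈ l.var, p ∉ r.var → θ p ∈ M.lookahead p) →
      Big M q (l.subst θ) (r.subst η)

/-- The links between occurrences of states in both trees. -/
def _root_.XTop.Form.Active {Q : Type u} (F : Form A B Q) (v w : List ℕ) : Prop :=
  (v, w) ∈ F.links ∧ v ∈ F.input.posLeaves ∧ w ∈ F.output.posLeaves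

/-- Active links are a bijection between output states and some of the input states. -/
structure _root_.XTop.Form.WellLinked {Q : Type u} (F : Form A B Q) : Prop where
  sentential : F.IsSentential
  biunique : ∀ v w v' w', F.Active v w → F.Active v' w' → (v = v' ↔ w = w')
  label : ∀ v w p p', F.Active v w → v ∈ F.input.posLeaf p → w ∈ F.output.posLeaf p' → p = p'
  total : ∀ w ∈ F.output.posLeaves, ∃ v, F.Active v w

/-- `(t, u)` arises from the form by big-step translations at its state occurrences. -/
structure Completes (M : Transducer A B) (F : Form A B M.State) (t : GTree A) (u : GTree B)
    (α : List ℕ → GTree A) (β : List ℕ → GTree B) : Prop where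
  input : F.input.fill α = t
  output : F.output.fill β = u
  linked : ∀ v w p, F.Active v w → v ∈ F.input.posLeaf p → M.Big p (α v) (β w)
  free : ∀ v p, v ∈ F.input.posLeaf p → (∀ w, ¬ F.Active v w) → α v ∈ M.lookahead p

theorem wellLinked_start (M : Transducer A B) (q : M.State) : (M.start q).WellLinked where
  sentential := isSentential_start M q
  biunique := by
    rintro v w v' w' ⟨h, -⟩ ⟨h', -⟩
    simp only [start, Set.mem_singleton_iff, Prod.mk.injEq] at h h'
    simp [h, h']
  label := by
    rintro v w p p' - hv hw
    simp only [start, mem_posLeaf_leaf] at hv hw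
    rw [← hv.2, ← hw.2]
  total := by
    rintro w ⟨p, hw⟩
    simp only [start, mem_posLeaf_leaf] at hw
    obtain ⟨rfl, -⟩ := hw
    exact ⟨[], by simp [start], ⟨q, by simp [start]⟩, ⟨q, by simp [start]⟩⟩

theorem completes_start {M : Transducer A B} {q : M.State} {t : GTree A} {u : GTree B} :
    (∃ α β, M.Completes (M.start q) t u α β) ↔ M.Big q t u := by
  have hact : (M.start q).Active [] [] :=
    ⟨by simp [start], ⟨q, by simp [start]⟩, ⟨q, by simp [start]⟩⟩
  constructor
  · rintro ⟨α, β, h⟩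
    have := h.linked [] [] q hact (by simp [start])
    rwa [← h.input, ← h.output]
  · intro h
    refine ⟨fun _ => t, fun _ => u, rfl, rfl, ?_, ?_⟩
    · intro v w p _ hv
      simp only [start, mem_posLeaf_leaf] at hv
      rwa [← hv.2]
    · intro v p hv hn
      simp only [start, mem_posLeaf_leaf] at hv
      exact (hn [] (hv.1 ▸ hact)).elim

theorem mem_posLeaves_replaceAt {A : RankedAlphabet.{u}} {S : Type u} {t u : RTree A S} {q : S}
    {v x : List ℕ} (hv : v ∈ t.posLeaf q) :
    x ∈ (t.replaceAt v u).posLeaves ↔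
      (∃ y, x = v ++ y ∧ y ∈ u.posLeaves) ∨ (x ≠ v ∧ x ∈ t.posLeaves) := by
  simp only [mem_posLeaves, mem_posLeaf_replaceAt hv]
  grind

section rule

variable {Q : Type u} {ξ : RTree A Q} {D : Set (List ℕ × List ℕ)} {ζ : RTree B Q}
  {l : RTree A Q} {r : RTree B Q} {q : Q} {v w : List ℕ}

/-- Links are never removed, so dead ones must be recognised. Since `l` is not a leaf, `v` stops
being a state position and old links at `v` die; by biuniqueness no other old active link ends at
`w`. -/
theorem active_rule (hF : (Form.mk ξ D ζ).WellLinked) (hl : ¬ l.IsLeaf) (hD : (v, w) ∈ D)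
    (hv : v ∈ ξ.posLeaf q) (hw : w ∈ ζ.posLeaf q) (v' w' : List ℕ) :
    (Form.mk (ξ.replaceAt v l) (D ∪ ruleLinks v w l r) (ζ.replaceAt w r)).Active v' w' ↔
      ((Form.mk ξ D ζ).Active v' w' ∧ v' ≠ v ∧ w' ≠ w) ∨
      ∃ p, ∃ x ∈ l.posLeaf p, ∃ y ∈ r.posLeaf p, v' = v ++ x ∧ w' = w ++ y := by
  have hact : (Form.mk ξ D ζ).Active v w := ⟨hD, ⟨q, hv⟩, ⟨q, hw⟩⟩
  simp only [Form.Active, mem_posLeaves_replaceAt hv, mem_posLeaves_replaceAt hw]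
  constructor
  · rintro ⟨h | ⟨p, x, hx, y, hy, he⟩, h₁, h₂⟩
    · obtain ⟨hp₁, hp₂⟩ := hF.sentential v' w' h
      have hv' : v' ≠ v ∧ v' ∈ ξ.posLeaves := by
        rcases h₁ with ⟨x, rfl, s, hx⟩ | h₁
        · obtain rfl := eq_nil_of_append_mem_pos hv hp₁
          cases l with
          | leaf s => exact (hl ⟨s, rfl⟩).elim
          | node a ts => simp at hx
        · exact h₁
      have hw' : w' ∈ ζ.posLeaves := by
        rcases h₂ with ⟨y, rfl, s, hy⟩ | h₂
        · obtain rfl := eq_nil_of_append_mem_pos hw hp₂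
          exact ⟨q, by simpa using hw⟩
        · exact h₂.2
      refine Or.inl ⟨⟨h, hv'.2, hw'⟩, hv'.1, fun he => hv'.1 ?_⟩
      exact (hF.biunique v' w' v w ⟨h, hv'.2, hw'⟩ hact).2 he
    · obtain ⟨rfl, rfl⟩ := Prod.mk.inj he
      exact Or.inr ⟨p, x, hx, y, hy, rfl, rfl⟩
  · rintro (⟨⟨h, h₁, h₂⟩, h₃, h₄⟩ | ⟨p, x, hx, y, hy, rfl, rfl⟩)
    · exact ⟨Or.inl h, Or.inr ⟨h₃, h₁⟩, Or.inr ⟨h₄, h₂⟩⟩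
    · exact ⟨Or.inr ⟨p, x, hx, y, hy, rfl⟩, Or.inl ⟨x, rfl, p, hx⟩, Or.inl ⟨y, rfl, p, hy⟩⟩

/-- Old and new links do not interfere because no position extends a leaf. Among new links,
biuniqueness is the linearity of both sides of the rule, and totality is `r.var ⊆ l.var`. -/
theorem wellLinked_rule (hF : (Form.mk ξ D ζ).WellLinked) (hl : ¬ l.IsLeaf)
    (hll : l.Linear) (hrl : r.Linear) (hrv : r.var ⊆ l.var) (hD : (v, w) ∈ D)
    (hv : v ∈ ξ.posLeaf q) (hw : w ∈ ζ.posLeaf q)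
    (hs : (Form.mk (ξ.replaceAt v l) (D ∪ ruleLinks v w l r) (ζ.replaceAt w r)).IsSentential) :
    (Form.mk (ξ.replaceAt v l) (D ∪ ruleLinks v w l r) (ζ.replaceAt w r)).WellLinked where
  sentential := hs
  biunique := by
    intro v₁ w₁ v₂ w₂ h₁ h₂
    rw [active_rule hF hl hD hv hw] at h₁ h₂
    rcases h₁ with ⟨h₁, hv₁, hw₁⟩ | ⟨p₁, x₁, hx₁, y₁, hy₁, rfl, rfl⟩ <;>
    rcases h₂ with ⟨h₂, hv₂, hw₂⟩ | ⟨p₂, x₂, hx₂, y₂, hy₂, rfl, rfl⟩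
    · exact hF.biunique _ _ _ _ h₁ h₂
    · exact iff_of_false
        (ne_append_of_mem_posLeaves hv (posLeaves_subset_pos _ h₁.2.1) hv₁)
        (ne_append_of_mem_posLeaves hw (posLeaves_subset_pos _ h₁.2.2) hw₁)
    · exact iff_of_false
        (ne_append_of_mem_posLeaves hv (posLeaves_subset_pos _ h₂.2.1) hv₂).symm
        (ne_append_of_mem_posLeaves hw (posLeaves_subset_pos _ h₂.2.2) hw₂).symm
    · simp only [List.append_cancel_left_eq]
      constructor
      · rintro rfl
        obtain rfl := posLeaf_unique hx₁ hx₂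
        exact hrl _ hy₁ hy₂
      · rintro rfl
        obtain rfl := posLeaf_unique hy₁ hy₂
        exact hll _ hx₁ hx₂
  label := by
    intro v' w' p p' h hp hp'
    rw [active_rule hF hl hD hv hw] at h
    simp only [mem_posLeaf_replaceAt hv] at hp
    simp only [mem_posLeaf_replaceAt hw] at hp'
    rcases h with ⟨h, hv', hw'⟩ | ⟨s, x, hx, y, hy, rfl, rfl⟩
    · have h₁ : v' ∈ ξ.posLeaf p := by
        rcases hp with ⟨x, hx, -⟩ | hp
        · exact (ne_append_of_mem_posLeaves hv (posLeaves_subset_pos _ h.2.1) hv' hx).elim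
        · exact hp.2
      have h₂ : w' ∈ ζ.posLeaf p' := by
        rcases hp' with ⟨x, hx, -⟩ | hp
        · exact (ne_append_of_mem_posLeaves hw (posLeaves_subset_pos _ h.2.2) hw' hx).elim
        · exact hp.2
      exact hF.label v' w' p p' h h₁ h₂
    · have h₁ : x ∈ l.posLeaf p := by
        rcases hp with ⟨x', hx', hp⟩ | ⟨hne, hp⟩
        · rwa [List.append_cancel_left hx']
        · exact (ne_append_of_mem_posLeaves hv (posLeaf_subset_pos _ _ hp) hne rfl).elim
      have h₂ : y ∈ r.posLeaf p' := by
        rcases hp' with ⟨x', hx', hp⟩ | ⟨hne, hp⟩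
        · rwa [List.append_cancel_left hx']
        · exact (ne_append_of_mem_posLeaves hw (posLeaf_subset_pos _ _ hp) hne rfl).elim
      rw [← posLeaf_unique hx h₁, ← posLeaf_unique hy h₂]
  total := by
    intro w' hw'
    simp only [mem_posLeaves_replaceAt hw] at hw'
    rcases hw' with ⟨y, rfl, p, hy⟩ | ⟨hne, hw'⟩
    · obtain ⟨x, hx⟩ := hrv ⟨y, hy⟩
      exact ⟨v ++ x, (active_rule hF hl hD hv hw _ _).2 (Or.inr ⟨p, x, hx, y, hy, rfl, rfl⟩)⟩
    · obtain ⟨v', hv'⟩ := hF.total w' hw'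
      refine ⟨v', (active_rule hF hl hD hv hw _ _).2 (Or.inl ⟨hv', fun he => hne ?_, hne⟩)⟩
      exact (hF.biunique v' w' v w hv' ⟨hD, ⟨q, hv⟩, ⟨q, hw⟩⟩).1 he

/-- The occurrence at `v` had no active link, and a ground tree introduces no state. -/
theorem active_look {t : GTree A} (hv : v ∈ ξ.posLeaf q)
    (hn : ∀ w, (v, w) ∈ D → w ∉ ζ.posLeaves) (v' w' : List ℕ) :
    (Form.mk (ξ.replaceAt v t.ofGround) D ζ).Active v' w' ↔ (Form.mk ξ D ζ).Active v' w' := by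
  simp only [Form.Active, mem_posLeaves_replaceAt hv]
  constructor
  · rintro ⟨h, ⟨x, rfl, s, hx⟩ | ⟨-, h₁⟩, h₂⟩
    · exact (posLeaf_ofGround _ _ _ hx).elim
    · exact ⟨h, h₁, h₂⟩
  · rintro ⟨h, h₁, h₂⟩
    exact ⟨h, Or.inr ⟨fun he => hn w' (he ▸ h) h₂, h₁⟩, h₂⟩

theorem mem_posLeaf_look {t : GTree A} (hv : v ∈ ξ.posLeaf q) {x : List ℕ} {p : Q} :
    x ∈ (ξ.replaceAt v t.ofGround).posLeaf p ↔ x ≠ v ∧ x ∈ ξ.posLeaf p := by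
  rw [mem_posLeaf_replaceAt hv]
  simp [posLeaf_ofGround]

theorem wellLinked_look {t : GTree A} (hF : (Form.mk ξ D ζ).WellLinked) (hv : v ∈ ξ.posLeaf q)
    (hn : ∀ w, (v, w) ∈ D → w ∉ ζ.posLeaves)
    (hs : (Form.mk (ξ.replaceAt v t.ofGround) D ζ).IsSentential) :
    (Form.mk (ξ.replaceAt v t.ofGround) D ζ).WellLinked where
  sentential := hs
  biunique := by
    intro v₁ w₁ v₂ w₂ h₁ h₂
    rw [active_look hv hn] at h₁ h₂
    exact hF.biunique _ _ _ _ h₁ h₂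
  label := by
    intro v' w' p p' h hp hp'
    rw [active_look hv hn] at h
    exact hF.label v' w' p p' h ((mem_posLeaf_look hv).1 hp).2 hp'
  total := by
    intro w' hw'
    obtain ⟨v', hv'⟩ := hF.total w' hw'
    exact ⟨v', (active_look hv hn _ _).2 hv'⟩

end rule

theorem Step.wellLinked {M : Transducer A B} (hM : M.EpsFree) {F G : Form A B M.State}
    (h : M.Step F G) (hF : F.WellLinked) : G.WellLinked := by
  have hs := h.isSentential hF.sentential
  cases h with
  | rule ξ D ζ l q r v w hr hD hv hw =>
    exact wellLinked_rule hF (hM _ _ _ hr) (M.linear_left _ _ _ hr) (M.linear_right _ _ _ hr)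
      (M.var_subset _ _ _ hr) hD hv hw hs
  | look ξ D ζ q v t hv hn ht => exact wellLinked_look hF hv hn hs

-- Completions pull back along a step. At the rewritten occurrence, the completions of the states of
-- the rule assemble into one `Big` step: states in `r` are linked, the others are free and satisfy
-- the look-ahead.
open Classical in
theorem Step.completes {M : Transducer A B} (hM : M.EpsFree) {F G : Form A B M.State}
    (h : M.Step F G) (hF : F.WellLinked) {t : GTree A} {u : GTree B}
    (hG : ∃ α β, M.Completes G t u α β) : ∃ α β, M.Completes F t u α β := by
  obtain ⟨α, β, hG⟩ := hG
  cases h with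
  | rule ξ D ζ l q r v w hr hD hv hw =>
    have hact := active_rule (r := r) hF (hM _ _ _ hr) hD hv hw
    have hactF : (Form.mk ξ D ζ).Active v w := ⟨hD, ⟨q, hv⟩, ⟨q, hw⟩⟩
    refine ⟨Function.update α v (l.fill fun x => α (v ++ x)),
      Function.update β w (r.fill fun x => β (w ++ x)), ?_, ?_, ?_, ?_⟩
    · rw [← hG.input, fill_replaceAt hv]
    · rw [← hG.output, fill_replaceAt hw]
    · intro v' w' p h hp
      by_cases hvv : v' = v
      · have hww := (hF.biunique v' w' v w h hactF).1 hvv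
        subst hvv hww
        obtain rfl := posLeaf_unique hv hp
        rw [Function.update_self, Function.update_self]
        obtain ⟨θ, hθ⟩ := (M.linear_left _ _ _ hr).exists_labelling fun x => α (v' ++ x)
        obtain ⟨η, hη⟩ := (M.linear_right _ _ _ hr).exists_labelling fun x => β (w' ++ x)
        rw [fill_eq_subst hθ, fill_eq_subst hη]
        refine Big.mk l q r θ η hr ?_ ?_
        · rintro p ⟨y, hy⟩
          obtain ⟨x, hx⟩ := M.var_subset _ _ _ hr ⟨y, hy⟩
          rw [← hθ p x hx, ← hη p y hy]
          exact hG.linked _ _ p ((hact _ _).2 (Or.inr ⟨p, x, hx, y, hy, rfl, rfl⟩))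
            ((mem_posLeaf_replaceAt hv).2 (Or.inl ⟨x, rfl, hx⟩))
        · rintro p ⟨x, hx⟩ hpr
          rw [← hθ p x hx]
          refine hG.free _ p ((mem_posLeaf_replaceAt hv).2 (Or.inl ⟨x, rfl, hx⟩)) ?_
          intro w₁ hw₁
          -- An active link at `v ++ x` can only come from the rule, and then `p` would occur in
          -- `r`.
          rcases (hact _ _).1 hw₁ with ⟨h₁, h₂, -⟩ | ⟨p', x', hx', y', hy', he, -⟩
          · exact ne_append_of_mem_posLeaves hv (posLeaves_subset_pos _ h₁.2.1) h₂ rfl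
          · rw [← List.append_cancel_left he] at hx'
            obtain rfl := posLeaf_unique hx hx'
            exact hpr ⟨y', hy'⟩
      · have hww : w' ≠ w := fun he => hvv ((hF.biunique v' w' v w h hactF).2 he)
        rw [Function.update_of_ne hvv, Function.update_of_ne hww]
        exact hG.linked v' w' p ((hact _ _).2 (Or.inl ⟨h, hvv, hww⟩))
          ((mem_posLeaf_replaceAt hv).2 (Or.inr ⟨hvv, hp⟩))
    · intro v' p hp hn
      have hvv : v' ≠ v := fun he => hn w (he ▸ hactF)
      rw [Function.update_of_ne hvv]
      refine hG.free v' p ((mem_posLeaf_replaceAt hv).2 (Or.inr ⟨hvv, hp⟩)) fun w' hw' => ?_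
      rcases (hact _ _).1 hw' with ⟨h₁, -⟩ | ⟨p', x', hx', y', hy', he, -⟩
      · exact hn w' h₁
      · exact ne_append_of_mem_posLeaves hv (posLeaf_subset_pos _ _ hp) hvv he
  | look ξ D ζ q v t' hv hn ht =>
    have hact := active_look (t := t') hv hn
    refine ⟨Function.update α v t', β, ?_, hG.output, ?_, ?_⟩
    · rw [← hG.input, fill_replaceAt hv, fill_ofGround]
    · intro v' w' p h hp
      have hvv : v' ≠ v := fun he => hn w' (he ▸ h.1) h.2.2
      rw [Function.update_of_ne hvv]
      exact hG.linked v' w' p ((hact _ _).2 h) ((mem_posLeaf_look hv).2 ⟨hvv, hp⟩)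
    · intro v' p hp hn'
      by_cases hvv : v' = v
      · subst hvv
        obtain rfl := posLeaf_unique hv hp
        rwa [Function.update_self]
      · rw [Function.update_of_ne hvv]
        exact hG.free v' p ((mem_posLeaf_look hv).2 ⟨hvv, hp⟩)
          fun w' hw' => hn' w' ((hact _ _).1 hw')

theorem exists_completes_of_reflTransGen {M : Transducer A B} (hM : M.EpsFree)
    {F : Form A B M.State} {t : GTree A} {D : Set (List ℕ × List ℕ)} {u : GTree B}
    (h : Relation.ReflTransGen M.Step F ⟨t.ofGround, D, u.ofGround⟩) (hF : F.WellLinked) :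
    ∃ α β, M.Completes F t u α β := by
  induction h using Relation.ReflTransGen.head_induction_on with
  | refl =>
    refine ⟨fun _ => t, fun _ => u, fill_ofGround _ _, fill_ofGround _ _, ?_, ?_⟩
    · intro v w p _ hp
      exact (posLeaf_ofGround _ _ _ hp).elim
    · intro v p hp
      exact (posLeaf_ofGround _ _ _ hp).elim
  | head hs _ ih => exact hs.completes hM hF (ih (hs.wellLinked hM hF))

open Classical in
/-- The assignment `α` with the values at the leaf positions of `l` below `v` overwritten. -/
noncomputable def graft {A C : RankedAlphabet.{u}} {S : Type u} (α : List ℕ → GTree C)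
    (v : List ℕ) (l : RTree A S) (θ : S → GTree C) (x : List ℕ) : GTree C :=
  if h : ∃ p, ∃ y ∈ l.posLeaf p, x = v ++ y then θ h.choose else α x

theorem graft_append {A C : RankedAlphabet.{u}} {S : Type u} {α : List ℕ → GTree C}
    {v : List ℕ} {l : RTree A S} {θ : S → GTree C} {p : S} {y : List ℕ} (hy : y ∈ l.posLeaf p) :
    graft α v l θ (v ++ y) = θ p := by
  have h : ∃ p, ∃ y' ∈ l.posLeaf p, v ++ y = v ++ y' := ⟨p, y, hy, rfl⟩
  rw [graft, dif_pos h]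
  obtain ⟨y', hy', he⟩ := h.choose_spec
  rw [← List.append_cancel_left he] at hy'
  rw [posLeaf_unique hy hy']

theorem graft_of_ne {A C : RankedAlphabet.{u}} {S : Type u} {α : List ℕ → GTree C}
    {v : List ℕ} {l t : RTree A S} {θ : S → GTree C} {q : S} {x : List ℕ}
    (hv : v ∈ t.posLeaf q) (hx : x ∈ t.pos) (hne : x ≠ v) : graft α v l θ x = α x := by
  rw [graft, dif_neg]
  rintro ⟨p, y, -, he⟩
  exact ne_append_of_mem_posLeaves hv hx hne he

theorem fill_graft {A : RankedAlphabet.{u}} {S : Type u} {α : List ℕ → GTree A}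
    {v : List ℕ} {l t : RTree A S} {θ : S → GTree A} {q : S} (hv : v ∈ t.posLeaf q)
    (h : α v = l.subst θ) : (t.replaceAt v l).fill (graft α v l θ) = t.fill α := by
  rw [fill_replaceAt hv]
  refine fill_congr fun w hw => ?_
  by_cases hwv : w = v
  · subst hwv
    rw [Function.update_self, h]
    exact fill_eq_subst fun s y hy => graft_append hy
  · rw [Function.update_of_ne hwv, graft_of_ne hv (posLeaves_subset_pos _ hw) hwv]

/-- A completion prescribes the next step: at a linked occurrence, the rule at the root of its `Big`
derivation; at a free one, a look-ahead step inserting `α v`. Either way the input gains an inner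
node, by ε-freeness in the first case. -/
theorem Completes.exists_step {M : Transducer A B} (hM : M.EpsFree) {F : Form A B M.State}
    (hF : F.WellLinked) {t : GTree A} {u : GTree B} {α : List ℕ → GTree A}
    {β : List ℕ → GTree B} (h : M.Completes F t u α β) {v : List ℕ}
    (hv : v ∈ F.input.posLeaves) :
    ∃ G, M.Step F G ∧ F.input.size < G.input.size ∧ ∃ α β, M.Completes G t u α β := by
  obtain ⟨ξ, D, ζ⟩ := F
  obtain ⟨q, hv⟩ := hv
  by_cases hw : ∃ w, (Form.mk ξ D ζ).Active v w
  · obtain ⟨w, hactF⟩ := hw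
    have hD := hactF.1
    obtain ⟨q', hw⟩ := hactF.2.2
    obtain rfl := hF.label _ _ _ _ hactF hv hw
    generalize ha : α v = a
    generalize hb : β w = b
    have hbig := h.linked v w q hactF hv
    rw [ha, hb] at hbig
    cases hbig with
    | mk l _ r θ η hr h₁ h₂ =>
      have hact := active_rule (r := r) hF (hM _ _ _ hr) hD hv hw
      refine ⟨_, Step.rule ξ D ζ l q r v w hr hD hv hw, ?_, graft α v l θ, graft β w r η,
        ?_, ?_, ?_, ?_⟩
      · have := size_pos_of_not_isLeaf (hM _ _ _ hr)
        simp only [size_replaceAt hv]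
        omega
      · rw [fill_graft hv ha]
        exact h.input
      · rw [fill_graft hw hb]
        exact h.output
      · intro v' w' p h' hp
        rcases (hact _ _).1 h' with ⟨h₃, h₄, h₅⟩ | ⟨p', x, hx, y, hy, rfl, rfl⟩
        · rw [graft_of_ne hv (posLeaves_subset_pos _ h₃.2.1) h₄,
            graft_of_ne hw (posLeaves_subset_pos _ h₃.2.2) h₅]
          refine h.linked v' w' p h₃ ?_
          rcases (mem_posLeaf_replaceAt hv).1 hp with ⟨x, hx, -⟩ | hp
          · exact (ne_append_of_mem_posLeaves hv (posLeaves_subset_pos _ h₃.2.1) h₄ hx).elim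
          · exact hp.2
        · have : p = p' := by
            rcases (mem_posLeaf_replaceAt hv).1 hp with ⟨x', hx', hp⟩ | ⟨hne, hp⟩
            · rw [← List.append_cancel_left hx'] at hp
              exact posLeaf_unique hp hx
            · exact (ne_append_of_mem_posLeaves hv (posLeaf_subset_pos _ _ hp) hne rfl).elim
          subst this
          rw [graft_append hx, graft_append hy]
          exact h₁ p ⟨y, hy⟩
      · intro v' p hp hn
        rcases (mem_posLeaf_replaceAt hv).1 hp with ⟨x, rfl, hx⟩ | ⟨hne, hp⟩
        · rw [graft_append hx]
          refine h₂ p ⟨x, hx⟩ fun ⟨y, hy⟩ => hn (w ++ y) ?_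
          exact (hact _ _).2 (Or.inr ⟨p, x, hx, y, hy, rfl, rfl⟩)
        · rw [graft_of_ne hv (posLeaf_subset_pos _ _ hp) hne]
          refine h.free v' p hp fun w' hw' => hn w' ((hact _ _).2 (Or.inl ⟨hw', hne, ?_⟩))
          exact fun he => hne ((hF.biunique _ _ _ _ hw' hactF).2 he)
  · have hn : ∀ w, (v, w) ∈ D → w ∉ ζ.posLeaves :=
      fun w hD hw' => hw ⟨w, hD, ⟨q, hv⟩, hw'⟩
    have hact := active_look (t := α v) hv hn
    refine ⟨_, Step.look ξ D ζ q v (α v) hv hn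
      (h.free v q hv fun w hw' => hw ⟨w, hw'⟩), ?_, α, β, ?_, h.output, ?_, ?_⟩
    · have := size_pos_of_ground (α v)
      simp only [size_replaceAt hv, size_ofGround]
      omega
    · rw [fill_replaceAt hv, fill_ofGround, Function.update_eq_self]
      exact h.input
    · intro v' w' p h' hp
      exact h.linked v' w' p ((hact _ _).1 h') ((mem_posLeaf_look hv).1 hp).2
    · intro v' p hp hn'
      exact h.free v' p ((mem_posLeaf_look hv).1 hp).2 fun w' hw' => hn' w' ((hact _ _).2 hw')

/-- The partial input never outgrows `t`, so the size difference decreases at every step. Once the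
input has no states, `WellLinked.total` excludes states in the output too. -/
theorem Completes.exists_reflTransGen {M : Transducer A B} (hM : M.EpsFree)
    {F : Form A B M.State} (hF : F.WellLinked) {t : GTree A} {u : GTree B}
    (h : ∃ α β, M.Completes F t u α β) :
    ∃ D, Relation.ReflTransGen M.Step F ⟨t.ofGround, D, u.ofGround⟩ := by
  induction hn : t.size - F.input.size using Nat.strong_induction_on generalizing F with
  | _ n ih =>
    obtain ⟨α, β, h⟩ := h
    by_cases hv : ∃ v, v ∈ F.input.posLeaves
    · obtain ⟨v, hv⟩ := hv
      obtain ⟨G, hs, hlt, α', β', hG⟩ := h.exists_step hM hF hv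
      have hle : G.input.size ≤ t.size := by
        rw [← hG.input]
        exact size_le_size_fill _ _
      obtain ⟨D, hD⟩ := ih _ (by omega) (hs.wellLinked hM hF) ⟨α', β', hG⟩ rfl
      exact ⟨D, hD.head hs⟩
    · push Not at hv
      have hw : ∀ w, w ∉ F.output.posLeaves := by
        intro w hw
        obtain ⟨v, hv'⟩ := hF.total w hw
        exact hv v hv'.2.1
      refine ⟨F.links, ?_⟩
      rw [← h.input, ← h.output, ofGround_fill hv, ofGround_fill hw]

/-- The derivation semantics of an ε-free transducer agrees with its big-step semantics. -/
theorem mem_transformation_iff {M : Transducer A B} (hM : M.EpsFree) {t : GTree A}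
    {u : GTree B} : (t, u) ∈ M.transformation ↔ ∃ q ∈ M.initial, M.Big q t u := by
  constructor
  · rintro ⟨D, q, hq, h⟩
    exact ⟨q, hq, completes_start.1 (exists_completes_of_reflTransGen hM h (wellLinked_start M q))⟩
  · rintro ⟨q, hq, h⟩
    obtain ⟨D, hD⟩ := Completes.exists_reflTransGen hM (wellLinked_start M q)
      (completes_start.2 h)
    exact ⟨D, q, hq, hD⟩

end Transducer
end XTop

namespace XTop
open RTree

variable {A B : RankedAlphabet.{u}} {S : Type u}

/-! ### Subterms and pattern languages -/

/-- The subterms of a tree. -/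
def RTree.subterms : RTree A S → Set (RTree A S)
  | leaf s => {leaf s}
  | node a ts => insert (node a ts) (⋃ i, (ts i).subterms)

theorem RTree.self_mem_subterms (t : RTree A S) : t ∈ t.subterms := by
  cases t <;> simp [subterms]

theorem RTree.finite_subterms (t : RTree A S) : t.subterms.Finite := by
  induction t with
  | leaf s => exact Set.finite_singleton _
  | node a ts ih => exact (Set.finite_iUnion ih).insert _

theorem RTree.child_mem_subterms {t : RTree A S} {a : A.Symbol} {ts : Fin (A.rk a) → RTree A S}
    (h : node a ts ∈ t.subterms) (i : Fin (A.rk a)) : ts i ∈ t.subterms := by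
  induction t with
  | leaf s => simp [subterms] at h
  | node b us ih =>
    simp only [subterms, Set.mem_insert_iff, Set.mem_iUnion] at h ⊢
    rcases h with h | ⟨j, h⟩
    · obtain ⟨rfl, h⟩ := node.inj h
      obtain rfl := eq_of_heq h
      exact Or.inr ⟨i, self_mem_subterms _⟩
    · exact Or.inr ⟨j, ih j h⟩

/-- `Matches c s t`: the tree `t` arises from `s` by replacing each occurrence of a leaf label `p`
by a tree of `c p`. -/
inductive Matches (c : S → Set (GTree A)) : RTree A S → GTree A → Prop
  | leaf (p : S) (t : GTree A) : t ∈ c p → Matches c (.leaf p) t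
  | node (a : A.Symbol) (ss : Fin (A.rk a) → RTree A S) (ts : Fin (A.rk a) → GTree A) :
      (∀ i, Matches c (ss i) (ts i)) → Matches c (.node a ss) (.node a ts)

theorem matches_leaf {c : S → Set (GTree A)} {p : S} {t : GTree A} :
    Matches c (.leaf p) t ↔ t ∈ c p := by
  constructor
  · rintro (⟨_, _, h⟩ | _)
    exact h
  · exact Matches.leaf p t

theorem matches_node {c : S → Set (GTree A)} {a : A.Symbol} {ss : Fin (A.rk a) → RTree A S}
    {t : GTree A} : Matches c (.node a ss) t ↔
      ∃ ts : Fin (A.rk a) → GTree A, t = .node a ts ∧ ∀ i, Matches c (ss i) (ts i) := by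
  constructor
  · intro h
    cases h with
    | node _ _ ts h => exact ⟨ts, rfl, h⟩
  · rintro ⟨ts, rfl, h⟩
    exact Matches.node a ss ts h

theorem matches_subst {c : S → Set (GTree A)} {s : RTree A S} {θ : S → GTree A}
    (h : ∀ p ∈ s.var, θ p ∈ c p) : Matches c s (s.subst θ) := by
  induction s with
  | leaf p => exact Matches.leaf _ _ (h p (by simp))
  | node a ss ih =>
    exact Matches.node _ _ _ fun i => ih i fun p hp => h p (mem_var_node.2 ⟨i, hp⟩)

/-- Assignments for the children of a linear tree can be merged. -/
theorem RTree.Linear.exists_merge {X : Type*} {a : A.Symbol} {ss : Fin (A.rk a) → RTree A S}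
    (h : (node a ss).Linear) (θ : Fin (A.rk a) → S → X) [Nonempty X] :
    ∃ η : S → X, ∀ i, ∀ p ∈ (ss i).var, η p = θ i p := by
  classical
  refine ⟨fun p => if hp : ∃ i, p ∈ (ss i).var then θ hp.choose p else Classical.arbitrary X,
    fun i p hp => ?_⟩
  have hp' : ∃ i, p ∈ (ss i).var := ⟨i, hp⟩
  simp only [dif_pos hp']
  rw [(linear_node.1 h).2 _ _ _ hp'.choose_spec hp]

/-- `Matches` treats occurrences independently; linearity lets these choices be merged into one
assignment of trees to labels. -/
theorem Matches.exists_subst {c : S → Set (GTree A)} {s : RTree A S} {t : GTree A}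
    (h : Matches c s t) (hs : s.Linear) :
    ∃ θ : S → GTree A, t = s.subst θ ∧ ∀ p ∈ s.var, θ p ∈ c p := by
  induction h with
  | leaf p t ht =>
    refine ⟨fun _ => t, rfl, fun p' hp' => ?_⟩
    rw [← mem_var_leaf.1 hp']
    exact ht
  | node a ss ts _ ih =>
    choose θ h₁ h₂ using fun i => ih i ((linear_node.1 hs).1 i)
    -- Without nullary symbols there are no ground trees, so a witness is taken from the tree at
    -- hand.
    have : Nonempty (GTree A) := ⟨.node a ts⟩
    obtain ⟨η, hη⟩ := hs.exists_merge θ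
    refine ⟨η, ?_, fun p hp => ?_⟩
    · simp only [subst]
      congr 1
      funext i
      rw [h₁ i]
      exact subst_congr fun p hp => (hη i p hp).symm
    · obtain ⟨i, hi⟩ := mem_var_node.1 hp
      rw [hη i p hi]
      exact h₂ i p hi

/-- A language is regular if it is saturated by the kernel of a map to a finite set which is a
congruence. -/
theorem isRegular_of_congruence {X : Type u} [Finite X] (f : GTree A → X)
    (hf : ∀ (a : A.Symbol) (ts us : Fin (A.rk a) → GTree A), (∀ i, f (ts i) = f (us i)) →
      f (.node a ts) = f (.node a us)) (F : Set X) : IsRegular {t | f t ∈ F} := by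
  classical
  let N : TreeAutomaton A :=
    { State := Option X
      -- The value `none` serves tuples of states not realised by any trees; on realised ones the
      -- congruence makes the choice of representatives irrelevant.
      step := fun a x => if h : ∃ ts : Fin (A.rk a) → GTree A, ∀ i, some (f (ts i)) = x i then
        some (f (.node a h.choose)) else none
      final := some '' F }
  have hN : ∀ t, N.run t = some (f t) := by
    intro t
    induction t with
    | leaf s => exact s.elim
    | node a ts ih =>
      have h : ∃ us : Fin (A.rk a) → GTree A, ∀ i, some (f (us i)) = N.run (ts i) :=
        ⟨ts, fun i => (ih i).symm⟩
      have h' := h.choose_spec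
      change (if h : ∃ us : Fin (A.rk a) → GTree A, ∀ i, some (f (us i)) = N.run (ts i) then
        some (f (.node a h.choose)) else none) = _
      rw [dif_pos h]
      congr 1
      refine hf _ _ _ fun i => ?_
      have := h' i
      rw [ih i] at this
      exact Option.some.inj this
  refine ⟨N, ?_⟩
  ext t
  change f t ∈ F ↔ N.run t ∈ some '' F
  rw [hN]
  exact (Option.some_injective X).mem_set_image.symm

theorem isRegular_univ : IsRegular (Set.univ : Set (GTree A)) := by
  simpa using isRegular_of_congruence (fun _ : GTree A => PUnit.unit) (fun _ _ _ _ => rfl) Set.univ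

/-- The congruence records the state of every look-ahead automaton and the set of subterms of `s`
matched so far. The former decides leaf subterms; the latter, taken at the children, decides the
other subterms. -/
theorem isRegular_matches [Finite S] {c : S → Set (GTree A)} (hc : ∀ p, IsRegular (c p))
    (s : RTree A S) : IsRegular {t | Matches c s t} := by
  choose N hN using hc
  have := fun p => (N p).finite
  have : Finite s.subterms := s.finite_subterms
  refine isRegular_of_congruence (X := (∀ p, (N p).State) × Set s.subterms)
    (fun t => (fun p => (N p).run t, {s' | Matches c s' t})) ?_
    {x | ⟨s, s.self_mem_subterms⟩ ∈ x.2}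
  intro a ts us h
  have h₁ : ∀ p, (N p).run (.node a ts) = (N p).run (.node a us) := by
    intro p
    simp only [TreeAutomaton.run]
    congr 1
    funext i
    exact congrFun (Prod.ext_iff.1 (h i)).1 p
  have h₂ : ∀ (i) (s' : s.subterms), Matches c s' (ts i) ↔ Matches c s' (us i) := fun i s' =>
    Set.ext_iff.1 (Prod.ext_iff.1 (h i)).2 s'
  refine Prod.ext (funext h₁) (Set.ext fun s' => ?_)
  obtain ⟨s', hs'⟩ := s'
  change Matches c s' _ ↔ Matches c s' _
  cases s' with
  | leaf p =>
    rw [matches_leaf, matches_leaf, hN p]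
    rw [Set.mem_ofPred_eq, Set.mem_ofPred_eq, h₁ p]
  | node b ss =>
    rw [matches_node, matches_node]
    constructor
    · rintro ⟨ts', he, hm⟩
      obtain ⟨rfl, he⟩ := node.inj he
      obtain rfl := eq_of_heq he
      exact ⟨us, rfl, fun i => (h₂ i ⟨_, child_mem_subterms hs' i⟩).1 (hm i)⟩
    · rintro ⟨ts', he, hm⟩
      obtain ⟨rfl, he⟩ := node.inj he
      obtain rfl := eq_of_heq he
      exact ⟨ts, rfl, fun i => (h₂ i ⟨_, child_mem_subterms hs' i⟩).2 (hm i)⟩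

end XTop

namespace XTop
open RTree

variable {A B : RankedAlphabet.{u}} {S T : Type u}

/-! ### Pruned trees -/

/-- The `j`-th element of a set of children. -/
noncomputable def kid {n : ℕ} (K : Finset (Fin n)) (j : Fin K.card) : Fin n := K.equivFin.symm j

theorem kid_mem {n : ℕ} (K : Finset (Fin n)) (j : Fin K.card) : kid K j ∈ K :=
  (K.equivFin.symm j).2

theorem kid_injective {n : ℕ} (K : Finset (Fin n)) : Function.Injective (kid K) :=
  Subtype.val_injective.comp K.equivFin.symm.injective

theorem exists_kid_eq {n : ℕ} {K : Finset (Fin n)} {i : Fin n} (hi : i ∈ K) :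
    ∃ j, kid K j = i := ⟨K.equivFin ⟨i, hi⟩, by simp [kid]⟩

/-- The symbols of `A` restricted to a set of children and optionally decorated by an element
of `R`. -/
abbrev prunedAlphabet (A : RankedAlphabet.{u}) (R : Type u) [Finite R] : RankedAlphabet.{u} where
  Symbol := Option R × (Σ a : A.Symbol, Finset (Fin (A.rk a)))
  finite := by
    have := A.finite
    infer_instance
  nonempty := by
    obtain ⟨a⟩ := A.nonempty
    exact ⟨none, a, ∅⟩
  rk x := x.2.2.card

/-- A symbol with no kept children has rank 0. This supplies default trees even when `A` has no
nullary symbol. -/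
instance (R : Type u) [Finite R] : Nonempty (GTree (prunedAlphabet A R)) := by
  obtain ⟨a⟩ := A.nonempty
  have : IsEmpty (Fin ((prunedAlphabet A R).rk (none, ⟨a, ∅⟩))) :=
    inferInstanceAs (IsEmpty (Fin 0))
  exact ⟨.node (A := prunedAlphabet A R) (none, ⟨a, ∅⟩) isEmptyElim⟩

namespace Transducer

variable (M : Transducer A B)

/-- The rules of `M` as a type. -/
abbrev Rule : Type u := M.rules

instance : Finite M.Rule := M.rules_finite

instance : Finite M.State := M.finite

variable {M}

/-- Some state of the right-hand side of `ρ` occurs in `s`. -/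
def Meets (ρ : M.Rule) (s : RTree A M.State) : Prop := ∃ p ∈ ρ.1.2.2.var, p ∈ s.var

open Classical in
/-- The children that contain states of the right-hand side of `ρ`. -/
noncomputable def keep (ρ : M.Rule) {n : ℕ} (ss : Fin n → RTree A M.State) : Finset (Fin n) :=
  Finset.univ.filter fun i => Meets ρ (ss i)

theorem mem_keep {ρ : M.Rule} {n : ℕ} {ss : Fin n → RTree A M.State} {i : Fin n} :
    i ∈ keep ρ ss ↔ Meets ρ (ss i) := by simp [keep]

/-- Apply the symbol `a`, restricted to the children kept by `ρ`. -/
noncomputable def prunedNode (ρ : M.Rule) (tag : Option M.Rule) {a : A.Symbol}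
    (ss : Fin (A.rk a) → RTree A M.State)
    (gs : Fin (A.rk a) → RTree (prunedAlphabet A M.Rule) T) :
    RTree (prunedAlphabet A M.Rule) T :=
  .node (A := prunedAlphabet A M.Rule) (tag, ⟨a, keep ρ ss⟩) fun j => gs (kid (keep ρ ss) j)

/-- The tree produced from trees `gs` for the children of a node with symbol `a`: if the
right-hand side of `ρ` is a state, then it is the tree for the child containing that state. -/
def Combine (ρ : M.Rule) (tag : Option M.Rule) {a : A.Symbol}
    (ss : Fin (A.rk a) → RTree A M.State)
    (gs : Fin (A.rk a) → RTree (prunedAlphabet A M.Rule) T)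
    (g : RTree (prunedAlphabet A M.Rule) T) : Prop :=
  (¬ ρ.1.2.2.IsLeaf ∧ g = prunedNode ρ tag ss gs) ∨
    ∃ p i, ρ.1.2.2 = .leaf p ∧ p ∈ (ss i).var ∧ g = gs i

/-- The output pattern for a subterm `s` of the left-hand side of `ρ`. -/
noncomputable def pattern (ρ : M.Rule) :
    Option M.Rule → RTree A M.State → RTree (prunedAlphabet A M.Rule) M.State
  | _, .leaf p => .leaf p
  | tag, .node _ ss => prunedNode ρ tag ss fun i => pattern ρ none (ss i)

open Classical in
/-- `pattern`, or the state which is the right-hand side of `ρ`. -/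
noncomputable def output (ρ : M.Rule) (tag : Option M.Rule) (s : RTree A M.State) :
    RTree (prunedAlphabet A M.Rule) M.State :=
  if h : ρ.1.2.2.IsLeaf then .leaf h.choose else pattern ρ tag s

theorem output_of_leaf {ρ : M.Rule} {p : M.State} (h : ρ.1.2.2 = .leaf p)
    (tag : Option M.Rule) (s : RTree A M.State) : output ρ tag s = .leaf p := by
  have h' : ρ.1.2.2.IsLeaf := ⟨p, h⟩
  rw [output, dif_pos h']
  rw [← leaf.inj (h.symm.trans h'.choose_spec)]

theorem output_of_not_isLeaf {ρ : M.Rule} (h : ¬ ρ.1.2.2.IsLeaf) (tag : Option M.Rule)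
    (s : RTree A M.State) : output ρ tag s = pattern ρ tag s := by
  rw [output, dif_neg h]

theorem mem_var_rhs_of_leaf {ρ : M.Rule} {p p' : M.State} (h : ρ.1.2.2 = .leaf p) :
    p' ∈ ρ.1.2.2.var ↔ p = p' := by
  rw [h, mem_var_leaf]

theorem mem_var_prunedNode {ρ : M.Rule} {tag : Option M.Rule} {a : A.Symbol}
    {ss : Fin (A.rk a) → RTree A M.State}
    {gs : Fin (A.rk a) → RTree (prunedAlphabet A M.Rule) T} {x : T} :
    x ∈ (prunedNode ρ tag ss gs).var ↔ ∃ i, Meets ρ (ss i) ∧ x ∈ (gs i).var := by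
  rw [prunedNode, mem_var_node]
  constructor
  · rintro ⟨j, hj⟩
    exact ⟨_, mem_keep.1 (kid_mem _ j), hj⟩
  · rintro ⟨i, hi, hx⟩
    obtain ⟨j, rfl⟩ := exists_kid_eq (mem_keep.2 hi)
    exact ⟨j, hx⟩

theorem linear_prunedNode {ρ : M.Rule} {tag : Option M.Rule} {a : A.Symbol}
    {ss : Fin (A.rk a) → RTree A M.State}
    {gs : Fin (A.rk a) → RTree (prunedAlphabet A M.Rule) T}
    (h₁ : ∀ i, Meets ρ (ss i) → (gs i).Linear)
    (h₂ : ∀ i j s, Meets ρ (ss i) → Meets ρ (ss j) → s ∈ (gs i).var → s ∈ (gs j).var → i = j) :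
    (prunedNode ρ tag ss gs).Linear := by
  rw [prunedNode, linear_node]
  exact ⟨fun j => h₁ _ (mem_keep.1 (kid_mem (keep ρ ss) j)), fun i j s hi hj => kid_injective _
    (h₂ _ _ s (mem_keep.1 (kid_mem _ i)) (mem_keep.1 (kid_mem _ j)) hi hj)⟩

theorem subst_prunedNode {U : Type u} {ρ : M.Rule} {tag : Option M.Rule} {a : A.Symbol}
    {ss : Fin (A.rk a) → RTree A M.State}
    {gs : Fin (A.rk a) → RTree (prunedAlphabet A M.Rule) T}
    (f : T → RTree (prunedAlphabet A M.Rule) U) :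
    (prunedNode ρ tag ss gs).subst f = prunedNode ρ tag ss fun i => (gs i).subst f := rfl

theorem prunedNode_congr {ρ : M.Rule} {tag : Option M.Rule} {a : A.Symbol}
    {ss : Fin (A.rk a) → RTree A M.State}
    {gs gs' : Fin (A.rk a) → RTree (prunedAlphabet A M.Rule) T}
    (h : ∀ i, Meets ρ (ss i) → gs i = gs' i) :
    prunedNode ρ tag ss gs = prunedNode ρ tag ss gs' := by
  rw [prunedNode, prunedNode]
  congr 1
  funext j
  exact h _ (mem_keep.1 (kid_mem (keep ρ ss) j))

theorem mem_var_of_meets_of_leaf {ρ : M.Rule} {p : M.State} (h : ρ.1.2.2 = .leaf p)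
    {s : RTree A M.State} (hs : Meets ρ s) : p ∈ s.var := by
  obtain ⟨p', hp', hs⟩ := hs
  rwa [(mem_var_rhs_of_leaf h).1 hp']

theorem Combine.subst {U : Type u} {ρ : M.Rule} {tag : Option M.Rule} {a : A.Symbol}
    {ss : Fin (A.rk a) → RTree A M.State}
    {gs : Fin (A.rk a) → RTree (prunedAlphabet A M.Rule) T}
    {g : RTree (prunedAlphabet A M.Rule) T} (h : Combine ρ tag ss gs g)
    (f : T → RTree (prunedAlphabet A M.Rule) U) :
    Combine ρ tag ss (fun i => (gs i).subst f) (g.subst f) := by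
  rcases h with ⟨h, rfl⟩ | ⟨p, i, h, hi, rfl⟩
  · exact Or.inl ⟨h, rfl⟩
  · exact Or.inr ⟨p, i, h, hi, rfl⟩

/-- Only kept children matter. In the erasing case linearity determines the child containing the
state, and that child is kept. -/
theorem Combine.unique {ρ : M.Rule} {tag : Option M.Rule} {a : A.Symbol}
    {ss : Fin (A.rk a) → RTree A M.State}
    {gs gs' : Fin (A.rk a) → RTree (prunedAlphabet A M.Rule) T}
    {g g' : RTree (prunedAlphabet A M.Rule) T} (hss : (node a ss).Linear)
    (h : Combine ρ tag ss gs g) (h' : Combine ρ tag ss gs' g')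
    (he : ∀ i, Meets ρ (ss i) → gs i = gs' i) : g = g' := by
  rcases h with ⟨h, rfl⟩ | ⟨p, i, h, hi, rfl⟩ <;>
  rcases h' with ⟨h', rfl⟩ | ⟨p', i', h', hi', rfl⟩
  · exact prunedNode_congr he
  · exact (h ⟨_, h'⟩).elim
  · exact (h' ⟨_, h⟩).elim
  · obtain rfl : p = p' := leaf.inj (h ▸ h')
    obtain rfl := (linear_node.1 hss).2 _ _ _ hi hi'
    exact he i ⟨p, (mem_var_rhs_of_leaf h).2 rfl, hi⟩

theorem Combine.mem_var {ρ : M.Rule} {tag : Option M.Rule} {a : A.Symbol}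
    {ss : Fin (A.rk a) → RTree A M.State}
    {gs : Fin (A.rk a) → RTree (prunedAlphabet A M.Rule) T}
    {g : RTree (prunedAlphabet A M.Rule) T} (hss : (node a ss).Linear)
    (h : Combine ρ tag ss gs g) (x : T) :
    x ∈ g.var ↔ ∃ i, Meets ρ (ss i) ∧ x ∈ (gs i).var := by
  rcases h with ⟨h, rfl⟩ | ⟨p, i, h, hi, rfl⟩
  · exact mem_var_prunedNode
  · constructor
    · exact fun hx => ⟨i, ⟨p, (mem_var_rhs_of_leaf h).2 rfl, hi⟩, hx⟩
    · rintro ⟨j, hj, hx⟩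
      rwa [(linear_node.1 hss).2 _ _ _ hi (mem_var_of_meets_of_leaf h hj)]

/-- If `r` is a state, it must occur below the current node, since otherwise there is no child to
pass on. -/
theorem combine_output {ρ : M.Rule} (tag : Option M.Rule) {a : A.Symbol}
    {ss : Fin (A.rk a) → RTree A M.State} (h : ρ.1.2.2.IsLeaf → Meets ρ (node a ss)) :
    Combine ρ tag ss (fun i => output ρ none (ss i)) (output ρ tag (node a ss)) := by
  by_cases hr : ρ.1.2.2.IsLeaf
  · have hm := h hr
    obtain ⟨p, hp⟩ := hr
    obtain ⟨i, hi⟩ := mem_var_node.1 (mem_var_of_meets_of_leaf hp hm)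
    exact Or.inr ⟨p, i, hp, hi, by simp only [output_of_leaf hp]⟩
  · refine Or.inl ⟨hr, ?_⟩
    rw [output_of_not_isLeaf hr, pattern]
    simp only [output_of_not_isLeaf hr]

/-- The side condition rules out a bare leaf foreign to `r`, which `pattern` would still emit. The
second alternative covers the root of `ℓ` when `r` is not a state, possibly ground: the root is then
kept even if none of its children is. -/
theorem mem_var_output {ρ : M.Rule} {s : RTree A M.State} {tag : Option M.Rule}
    (hs : s.Linear) (h : Meets ρ s ∨ ¬ s.IsLeaf ∧ ¬ ρ.1.2.2.IsLeaf) (x : M.State) :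
    x ∈ (output ρ tag s).var ↔ x ∈ s.var ∧ x ∈ ρ.1.2.2.var := by
  induction s generalizing tag with
  | leaf p =>
    have hp : p ∈ ρ.1.2.2.var := by
      rcases h with ⟨p', hp', h⟩ | h
      · rwa [mem_var_leaf.1 h]
      · exact (h.1 ⟨p, rfl⟩).elim
    have : output ρ tag (leaf p) = leaf p := by
      by_cases hr : ρ.1.2.2.IsLeaf
      · obtain ⟨p', hp'⟩ := hr
        rw [output_of_leaf hp', (mem_var_rhs_of_leaf hp').1 hp]
      · rw [output_of_not_isLeaf hr, pattern]
    rw [this, mem_var_leaf, mem_var_leaf]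
    constructor
    · rintro rfl
      exact ⟨rfl, hp⟩
    · exact And.left
  | node a ss ih =>
    have hc := combine_output tag (ρ := ρ) (ss := ss) fun hr => h.resolve_right fun h => h.2 hr
    rw [hc.mem_var hs]
    constructor
    · rintro ⟨i, hi, hx⟩
      rw [ih i ((linear_node.1 hs).1 i) (Or.inl hi)] at hx
      exact ⟨mem_var_node.2 ⟨i, hx.1⟩, hx.2⟩
    · rintro ⟨hx, hr⟩
      obtain ⟨i, hi⟩ := mem_var_node.1 hx
      have hm : Meets ρ (ss i) := ⟨x, hr, hi⟩
      exact ⟨i, hm, (ih i ((linear_node.1 hs).1 i) (Or.inl hm)).2 ⟨hi, hr⟩⟩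

theorem linear_output {ρ : M.Rule} {s : RTree A M.State} {tag : Option M.Rule}
    (hs : s.Linear) : (output ρ tag s).Linear := by
  by_cases hr : ρ.1.2.2.IsLeaf
  · obtain ⟨p, hp⟩ := hr
    rw [output_of_leaf hp]
    exact linear_leaf p
  · rw [output_of_not_isLeaf hr]
    induction s generalizing tag with
    | leaf p => exact linear_leaf p
    | node a ss ih =>
      refine linear_prunedNode (fun i _ => ih i ((linear_node.1 hs).1 i)) ?_
      intro i j x hi hj hx hx'
      rw [← output_of_not_isLeaf hr, mem_var_output ((linear_node.1 hs).1 i) (Or.inl hi)] at hx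
      rw [← output_of_not_isLeaf hr, mem_var_output ((linear_node.1 hs).1 j) (Or.inl hj)] at hx'
      exact (linear_node.1 hs).2 i j x hx.1 hx'.1

/-! ### The delabeling transducer -/

variable (M) in
/-- The states of `M` and the subterms of the left-hand sides of its rules. -/
def patternTerms : Set (RTree A M.State) :=
  Set.range RTree.leaf ∪ ⋃ ρ : M.Rule, ρ.1.1.subterms

variable (M) in
theorem finite_patternTerms : M.patternTerms.Finite :=
  (Set.finite_range _).union (Set.finite_iUnion fun ρ => ρ.1.1.finite_subterms)

theorem child_mem_patternTerms {a : A.Symbol} {ss : Fin (A.rk a) → RTree A M.State}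
    (h : node a ss ∈ M.patternTerms) (i : Fin (A.rk a)) : ss i ∈ M.patternTerms := by
  rcases h with ⟨p, hp⟩ | h
  · cases hp
  · obtain ⟨ρ, hρ⟩ := Set.mem_iUnion.1 h
    exact Or.inr (Set.mem_iUnion.2 ⟨ρ, child_mem_subterms hρ i⟩)

theorem leaf_mem_patternTerms (p : M.State) : leaf p ∈ M.patternTerms := Or.inl ⟨p, rfl⟩

theorem lhs_mem_patternTerms (ρ : M.Rule) : ρ.1.1 ∈ M.patternTerms :=
  Or.inr (Set.mem_iUnion.2 ⟨ρ, self_mem_subterms _⟩)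

theorem _root_.XTop.RTree.Linear.of_mem_subterms {s t : RTree A S} (ht : t.Linear)
    (hs : s ∈ t.subterms) : s.Linear := by
  induction t with
  | leaf p =>
    rw [show s = leaf p from hs]
    exact linear_leaf p
  | node a ts ih =>
    rcases hs with rfl | hs
    · exact ht
    · obtain ⟨i, hi⟩ := Set.mem_iUnion.1 hs
      exact ih i ((linear_node.1 ht).1 i) hi

theorem linear_lhs (ρ : M.Rule) : ρ.1.1.Linear := M.linear_left _ ρ.1.2.1 ρ.1.2.2 ρ.2

theorem linear_of_mem_patternTerms {s : RTree A M.State} (h : s ∈ M.patternTerms) :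
    s.Linear := by
  rcases h with ⟨p, rfl⟩ | h
  · exact linear_leaf p
  · obtain ⟨ρ, hρ⟩ := Set.mem_iUnion.1 h
    exact (linear_lhs ρ).of_mem_subterms hρ

variable (M) in
/-- The states of the delabeling transducer. The first component tells the child number, the
second one the rule that is being applied, the last one the remaining part of its left-hand
side. -/
abbrev FrontState : Type u := Option (Σ a : A.Symbol, Fin (A.rk a)) × M.Rule × M.patternTerms

instance : Finite M.FrontState := by
  have := A.finite
  have : Finite M.patternTerms := M.finite_patternTerms
  infer_instance

/-- The state for the `i`-th child of a node. -/
def childState (ρ : M.Rule) {a : A.Symbol} (ss : Fin (A.rk a) → M.patternTerms)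
    (i : Fin (A.rk a)) : M.FrontState := (some ⟨a, i⟩, ρ, ss i)

theorem childState_injective (ρ : M.Rule) {a : A.Symbol} (ss : Fin (A.rk a) → M.patternTerms) :
    Function.Injective (childState ρ ss) := by
  intro i j h
  simpa [childState] using (Prod.ext_iff.1 h).1

/-- The state `st` expects the tree `s` in an application of `ρ`; the output symbol at the root of
an application of `ρ` is tagged with `ρ`. -/
def Expands (st : M.FrontState) (tag : Option M.Rule) (ρ : M.Rule) (s : RTree A M.State) : Prop :=
  (tag = none ∧ st.2.1 = ρ ∧ (st.2.2 : RTree A M.State) = s) ∨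
    (tag = some ρ ∧ (st.2.2 : RTree A M.State) = leaf ρ.1.2.1 ∧ ρ.1.1 = s)

theorem Expands.mem_patternTerms {st : M.FrontState} {tag : Option M.Rule} {ρ : M.Rule}
    {s : RTree A M.State} (h : Expands st tag ρ s) : s ∈ M.patternTerms := by
  rcases h with ⟨-, -, rfl⟩ | ⟨-, -, rfl⟩
  · exact st.2.2.2
  · exact lhs_mem_patternTerms ρ

variable (M) in
/-- The rules of the delabeling transducer. -/
def frontRules : Set (RTree A M.FrontState × M.FrontState ×
    RTree (prunedAlphabet A M.Rule) M.FrontState) :=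
  {x | ∃ (tag : Option M.Rule) (ρ : M.Rule) (a : A.Symbol) (ss : Fin (A.rk a) → M.patternTerms),
    Expands x.2.1 tag ρ (node a fun i => (ss i : RTree A M.State)) ∧
    x.1 = node a (fun i => leaf (childState ρ ss i)) ∧
    Combine ρ tag (fun i => (ss i : RTree A M.State)) (fun i => leaf (childState ρ ss i)) x.2.2}

-- Rules are bounded by finite data: a tag, a rule, a symbol and a tuple of pattern terms, with a
-- right-hand side that is a pruned node or a leaf.
variable (M) in
theorem finite_frontRules : M.frontRules.Finite := by
  have := A.finite
  have : Finite M.patternTerms := M.finite_patternTerms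
  let P := Σ a : A.Symbol, M.Rule × (Fin (A.rk a) → M.patternTerms)
  let L : P → RTree A M.FrontState := fun x => node x.1 fun i => leaf (childState x.2.1 x.2.2 i)
  let R₁ : Option M.Rule × P → RTree (prunedAlphabet A M.Rule) M.FrontState := fun x =>
    prunedNode x.2.2.1 x.1 (fun i => (x.2.2.2 i : RTree A M.State))
      (fun i => leaf (childState x.2.2.1 x.2.2.2 i))
  refine ((Set.finite_range L).prod (Set.finite_univ.prod
    ((Set.finite_range R₁).union (Set.finite_range RTree.leaf)))).subset ?_
  rintro ⟨l, st, r⟩ ⟨tag, ρ, a, ss, -, rfl, h⟩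
  refine ⟨⟨⟨a, ρ, ss⟩, rfl⟩, Set.mem_univ _, ?_⟩
  rcases h with ⟨-, h⟩ | ⟨p, i, -, -, h⟩
  · exact Or.inl ⟨⟨tag, a, ρ, ss⟩, h.symm⟩
  · exact Or.inr ⟨_, h.symm⟩

variable (M) in
/-- The delabeling transducer, which checks the left-hand sides of the rules, deletes the parts
without output and marks the remaining nodes. -/
def front : Transducer A (prunedAlphabet A M.Rule) where
  State := M.FrontState
  initial := {st | ∃ q ∈ M.initial, (st.2.2 : RTree A M.State) = leaf q}
  rules := M.frontRules
  rules_finite := M.finite_frontRules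
  linear_left := by
    rintro l st r ⟨tag, ρ, a, ss, -, rfl, -⟩
    refine linear_node.2 ⟨fun i => linear_leaf _, fun i j s hi hj => ?_⟩
    rw [mem_var_leaf] at hi hj
    -- Siblings may be equal ground subterms; the child number in the state keeps the left-hand side
    -- linear.
    exact childState_injective ρ ss (hi.trans hj.symm)
  linear_right := by
    rintro l st r ⟨tag, ρ, a, ss, -, -, h⟩
    rcases h with ⟨-, rfl⟩ | ⟨p, i, -, -, rfl⟩
    · refine linear_prunedNode (fun i _ => linear_leaf _) fun i j s _ _ hi hj => ?_
      rw [mem_var_leaf] at hi hj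
      exact childState_injective ρ ss (hi.trans hj.symm)
    · exact linear_leaf _
  var_subset := by
    rintro l st r ⟨tag, ρ, a, ss, hE, rfl, h⟩ x hx
    obtain ⟨i, -, hi⟩ := (h.mem_var (linear_of_mem_patternTerms hE.mem_patternTerms) x).1 hx
    exact mem_var_node.2 ⟨i, by simpa using hi⟩
  lookahead st := {t | Matches M.lookahead st.2.2 t}
  lookahead_regular st := isRegular_matches M.lookahead_regular _

theorem topDown_front : M.front.TopDown := by
  rintro l st r ⟨tag, ρ, a, ss, -, rfl, -⟩
  exact ⟨a, _, rfl⟩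

theorem TopDown.epsFree {M : Transducer A B} (h : M.TopDown) : M.EpsFree := by
  rintro l q r hr ⟨s, rfl⟩
  obtain ⟨a, s', he⟩ := h _ _ _ hr
  cases he

theorem delabeling_front : M.front.Delabeling := by
  intro l st r h
  refine ⟨topDown_front l st r h, ?_⟩
  obtain ⟨tag, ρ, a, ss, -, -, h⟩ := h
  rcases h with ⟨-, rfl⟩ | ⟨p, i, -, -, rfl⟩
  · exact Or.inr ⟨_, _, rfl⟩
  · exact Or.inl ⟨_, rfl⟩

theorem Strict.front (hM : M.Strict) : M.front.Strict := by
  rintro l st r ⟨tag, ρ, a, ss, -, -, h⟩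
  rcases h with ⟨-, rfl⟩ | ⟨p, i, h, -, -⟩
  · rintro ⟨_, h⟩
    cases h
  · exact (hM _ _ _ ρ.2 ⟨p, h⟩).elim

/-! ### Runs of the delabeling transducer through a left-hand side -/

/-- Distinct children carry distinct states, so an assignment to states is the same as a tuple of
trees for the children, and one step can be read without mentioning states. -/
theorem big_front_iff {st : M.FrontState} {t : GTree A} {g : GTree (prunedAlphabet A M.Rule)} :
    M.front.Big st t g ↔ ∃ (tag : Option M.Rule) (ρ : M.Rule) (a : A.Symbol)
      (ss : Fin (A.rk a) → M.patternTerms) (ts : Fin (A.rk a) → GTree A)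
      (gs : Fin (A.rk a) → GTree (prunedAlphabet A M.Rule)),
      Expands st tag ρ (node a fun i => (ss i : RTree A M.State)) ∧ t = node a ts ∧
      Combine ρ tag (fun i => (ss i : RTree A M.State)) gs g ∧
      (∀ i, Meets ρ (ss i) → M.front.Big (childState ρ ss i) (ts i) (gs i)) ∧
      ∀ i, ¬ Meets ρ (ss i) → Matches M.lookahead (ss i) (ts i) := by
  constructor
  · rintro ⟨l, _, r, θ, η, hr, h₁, h₂⟩
    obtain ⟨tag, ρ, a, ss, hE, hl, hc⟩ := hr
    dsimp only at hE hl hc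
    subst hl
    have hv := hc.mem_var (linear_of_mem_patternTerms hE.mem_patternTerms)
    refine ⟨tag, ρ, a, ss, fun i => θ (childState ρ ss i), fun i => η (childState ρ ss i), hE,
      rfl, hc.subst η, fun i hi => h₁ _ ((hv _).2 ⟨i, hi, by simp⟩), fun i hi => ?_⟩
    refine h₂ (childState ρ ss i) (mem_var_node.2 ⟨i, mem_var_leaf.2 rfl⟩) fun hi' => hi ?_
    obtain ⟨j, hj, he⟩ := (hv _).1 hi'
    rw [mem_var_leaf] at he
    rwa [← childState_injective ρ ss he]
  · rintro ⟨tag, ρ, a, ss, ts, gs, hE, rfl, hc, h₁, h₂⟩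
    have hinj := childState_injective ρ ss
    have hlin := linear_of_mem_patternTerms hE.mem_patternTerms
    obtain ⟨r, hr⟩ : ∃ r : RTree (prunedAlphabet A M.Rule) M.FrontState,
        Combine ρ tag (fun i => (ss i : RTree A M.State))
          (fun i => leaf (childState ρ ss i)) r := by
      rcases hc with ⟨h, -⟩ | ⟨p, i, h, hi, -⟩
      · exact ⟨_, Or.inl ⟨h, rfl⟩⟩
      · exact ⟨_, Or.inr ⟨p, i, h, hi, rfl⟩⟩
    -- The default outside the range of `childState` is never used.
    let θ : M.FrontState → GTree A := Function.extend (childState ρ ss) ts fun _ => node a ts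
    let η : M.FrontState → GTree (prunedAlphabet A M.Rule) :=
      Function.extend (childState ρ ss) gs fun _ => g
    have hθ : ∀ i, θ (childState ρ ss i) = ts i := fun i => hinj.extend_apply _ _ i
    have hη : ∀ i, η (childState ρ ss i) = gs i := fun i => hinj.extend_apply _ _ i
    have hg : g = r.subst η := hc.unique hlin (hr.subst η) fun i _ => (hη i).symm
    have ht : node a ts = (node a fun i => leaf (childState ρ ss i)).subst θ := by
      simp only [RTree.subst, hθ]
    rw [hg, ht]
    refine Big.mk (M := M.front) _ st r θ η ⟨tag, ρ, a, ss, hE, rfl, hr⟩ ?_ ?_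
    · intro x hx
      obtain ⟨i, hi, hx⟩ := (hr.mem_var hlin x).1 hx
      rw [← mem_var_leaf.1 hx, hθ, hη]
      exact h₁ i hi
    · intro x hx hx'
      obtain ⟨i, hi⟩ := mem_var_node.1 hx
      obtain rfl := mem_var_leaf.1 hi
      rw [hθ]
      exact h₂ i fun hm => hx' ((hr.mem_var hlin _).2 ⟨i, hm, by simp⟩)

theorem big_front_node {st : M.FrontState} {tag : Option M.Rule} {ρ : M.Rule} {a : A.Symbol}
    {ss : Fin (A.rk a) → RTree A M.State} {θ : M.State → GTree A}
    {γ : M.State → GTree (prunedAlphabet A M.Rule)} (hE : Expands st tag ρ (node a ss))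
    (hm : ρ.1.2.2.IsLeaf → Meets ρ (node a ss))
    (h₁ : ∀ (i : Fin (A.rk a)) (k : Option (Σ a : A.Symbol, Fin (A.rk a)))
      (hi : ss i ∈ M.patternTerms), Meets ρ (ss i) →
      M.front.Big (k, ρ, ⟨ss i, hi⟩) ((ss i).subst θ) ((output ρ none (ss i)).subst γ))
    (h₂ : ∀ p ∈ (node a ss).var, p ∉ ρ.1.2.2.var → θ p ∈ M.lookahead p) :
    M.front.Big st ((node a ss).subst θ) ((output ρ tag (node a ss)).subst γ) := by
  refine big_front_iff.2 ⟨tag, ρ, a, fun i => ⟨ss i, child_mem_patternTerms hE.mem_patternTerms i⟩,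
    _, _, hE, rfl, (combine_output tag hm).subst γ, fun i hi => h₁ i _ _ hi, fun i hi => ?_⟩
  refine matches_subst fun p hp => h₂ p (mem_var_node.2 ⟨i, hp⟩) fun hp' => hi ⟨p, hp', hp⟩

/-- Induction along the part of the left-hand side still to be read. At a leaf `p` a new application
starts, so `h₁` must allow whatever child number and rule the state happens to carry. -/
theorem big_front_subst {ρ : M.Rule} {s : RTree A M.State} {θ : M.State → GTree A}
    {γ : M.State → GTree (prunedAlphabet A M.Rule)}
    (k : Option (Σ a : A.Symbol, Fin (A.rk a))) (hs : s ∈ M.patternTerms) (hm : Meets ρ s)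
    (h₁ : ∀ p ∈ ρ.1.2.2.var, ∀ k ρ', M.front.Big (k, ρ', ⟨leaf p, leaf_mem_patternTerms p⟩)
      (θ p) (γ p))
    (h₂ : ∀ p ∈ s.var, p ∉ ρ.1.2.2.var → θ p ∈ M.lookahead p) :
    M.front.Big (k, ρ, ⟨s, hs⟩) (s.subst θ) ((output ρ none s).subst γ) := by
  induction s generalizing k with
  | leaf p =>
    obtain ⟨p', hp, hp'⟩ := hm
    obtain rfl := mem_var_leaf.1 hp'
    have : output ρ none (leaf p) = leaf p := by
      by_cases hr : ρ.1.2.2.IsLeaf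
      · obtain ⟨p', hp'⟩ := hr
        rw [output_of_leaf hp', (mem_var_rhs_of_leaf hp').1 hp]
      · rw [output_of_not_isLeaf hr, pattern]
    rw [this]
    exact h₁ p hp k ρ
  | node a ss ih =>
    refine big_front_node (Or.inl ⟨rfl, rfl, rfl⟩) (fun _ => hm) (fun i k hi hmi => ?_) h₂
    exact ih i k hi hmi fun p hp => h₂ p (mem_var_node.2 ⟨i, hp⟩)

/-- `t` and `g` are instances of `s` and its output pattern. -/
def Parsed (ρ : M.Rule) (tag : Option M.Rule) (s : RTree A M.State) (t : GTree A)
    (g : GTree (prunedAlphabet A M.Rule)) : Prop :=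
  ∃ (θ : M.State → GTree A) (γ : M.State → GTree (prunedAlphabet A M.Rule)),
    t = s.subst θ ∧ g = (output ρ tag s).subst γ ∧
    (∀ p ∈ s.var, p ∈ ρ.1.2.2.var →
      ∃ k ρ', M.front.Big (k, ρ', ⟨leaf p, leaf_mem_patternTerms p⟩) (θ p) (γ p)) ∧
    ∀ p ∈ s.var, p ∉ ρ.1.2.2.var → θ p ∈ M.lookahead p

/-- Linearity of the pattern lets the assignments found at the children be glued; deleted children
contribute theirs through `Matches.exists_subst`. -/
theorem parsed_node {tag : Option M.Rule} {ρ : M.Rule} {a : A.Symbol}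
    {ss : Fin (A.rk a) → RTree A M.State} {ts : Fin (A.rk a) → GTree A}
    {gs : Fin (A.rk a) → GTree (prunedAlphabet A M.Rule)} {g : GTree (prunedAlphabet A M.Rule)}
    (hlin : (node a ss).Linear) (hm : ρ.1.2.2.IsLeaf → Meets ρ (node a ss))
    (hc : Combine ρ tag ss gs g)
    (h₁ : ∀ i, Meets ρ (ss i) → Parsed ρ none (ss i) (ts i) (gs i))
    (h₂ : ∀ i, ¬ Meets ρ (ss i) → Matches M.lookahead (ss i) (ts i)) :
    Parsed ρ tag (node a ss) (node a ts) g := by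
  have hex : ∀ i, ∃ (θ : M.State → GTree A) (γ : M.State → GTree (prunedAlphabet A M.Rule)),
      ts i = (ss i).subst θ ∧ (Meets ρ (ss i) → gs i = (output ρ none (ss i)).subst γ) ∧
      (∀ p ∈ (ss i).var, p ∈ ρ.1.2.2.var →
        ∃ k ρ', M.front.Big (k, ρ', ⟨leaf p, leaf_mem_patternTerms p⟩) (θ p) (γ p)) ∧
      ∀ p ∈ (ss i).var, p ∉ ρ.1.2.2.var → θ p ∈ M.lookahead p := by
    intro i
    by_cases hi : Meets ρ (ss i)
    · obtain ⟨θ, γ, h₃, h₄, h₅⟩ := h₁ i hi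
      exact ⟨θ, γ, h₃, fun _ => h₄, h₅⟩
    · obtain ⟨θ, h₃, h₄⟩ := (h₂ i hi).exists_subst ((linear_node.1 hlin).1 i)
      exact ⟨θ, fun _ => g, h₃, fun h => (hi h).elim, fun p hp hp' => (hi ⟨p, hp', hp⟩).elim,
        fun p hp _ => h₄ p hp⟩
  choose θ γ h₃ h₄ h₅ h₆ using hex
  have : Nonempty (GTree A) := ⟨node a ts⟩
  obtain ⟨θ', hθ⟩ := hlin.exists_merge θ
  obtain ⟨γ', hγ⟩ := hlin.exists_merge γ
  refine ⟨θ', γ', ?_, ?_, fun p hp hp' => ?_, fun p hp hp' => ?_⟩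
  · simp only [RTree.subst]
    congr 1
    funext i
    rw [h₃ i]
    exact subst_congr fun p hp => (hθ i p hp).symm
  · refine hc.unique hlin ((combine_output tag hm).subst γ') fun i hi => ?_
    rw [h₄ i hi]
    refine subst_congr fun p hp => (hγ i p ?_).symm
    exact ((mem_var_output ((linear_node.1 hlin).1 i) (Or.inl hi) p).1 hp).1
  · obtain ⟨i, hi⟩ := mem_var_node.1 hp
    rw [hθ i p hi, hγ i p hi]
    exact h₅ i p hi hp'
  · obtain ⟨i, hi⟩ := mem_var_node.1 hp
    rw [hθ i p hi]
    exact h₆ i p hi hp'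

/-- Inside a left-hand side `front` has no choice of rule: a state whose remaining subterm is not a
leaf admits only untagged expansions with its own rule. -/
theorem parsed_of_big_front {ρ : M.Rule} {s : RTree A M.State} {t : GTree A}
    {g : GTree (prunedAlphabet A M.Rule)} {k : Option (Σ a : A.Symbol, Fin (A.rk a))}
    {hs : s ∈ M.patternTerms} (hm : Meets ρ s) (h : M.front.Big (k, ρ, ⟨s, hs⟩) t g) :
    Parsed ρ none s t g := by
  induction s generalizing k t g with
  | leaf p =>
    obtain ⟨p', hp, hp'⟩ := hm
    obtain rfl := mem_var_leaf.1 hp'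
    refine ⟨fun _ => t, fun _ => g, rfl, ?_, ?_, ?_⟩
    · by_cases hr : ρ.1.2.2.IsLeaf
      · obtain ⟨p', hp'⟩ := hr
        rw [output_of_leaf hp', RTree.subst]
      · rw [output_of_not_isLeaf hr, pattern, RTree.subst]
    · intro p' hp' _
      obtain rfl := mem_var_leaf.1 hp'
      exact ⟨k, ρ, h⟩
    · intro p' hp' hn
      rw [← mem_var_leaf.1 hp'] at hn
      exact (hn hp).elim
  | node a ss ih =>
    obtain ⟨tag, ρ', a', ss', ts, gs, hE, rfl, hc, h₁, h₂⟩ := big_front_iff.1 h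
    rcases hE with ⟨rfl, rfl, he⟩ | ⟨-, he, -⟩
    · obtain ⟨rfl, he⟩ := node.inj he
      obtain rfl := eq_of_heq he
      exact parsed_node (linear_of_mem_patternTerms hs) (fun _ => hm) hc
        (fun i hi => ih i hi (h₁ i hi)) h₂
    · cases he

theorem meets_lhs_of_isLeaf {ρ : M.Rule} (h : ρ.1.2.2.IsLeaf) : Meets ρ ρ.1.1 := by
  obtain ⟨p, hp⟩ := h
  have hp' := (mem_var_rhs_of_leaf hp).2 rfl
  exact ⟨p, hp', M.var_subset _ _ _ ρ.2 hp'⟩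

/-- A leaf subterm can be expanded only by guessing a new rule for that state, after which the whole
left-hand side is parsed. -/
theorem exists_rule_of_big_front {q : M.State} {t : GTree A}
    {g : GTree (prunedAlphabet A M.Rule)} {k : Option (Σ a : A.Symbol, Fin (A.rk a))}
    {ρ' : M.Rule} {hq : leaf q ∈ M.patternTerms} (h : M.front.Big (k, ρ', ⟨leaf q, hq⟩) t g) :
    ∃ ρ : M.Rule, ρ.1.2.1 = q ∧ Parsed ρ (some ρ) ρ.1.1 t g := by
  obtain ⟨tag, ρ, a, ss, ts, gs, hE, rfl, hc, h₁, h₂⟩ := big_front_iff.1 h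
  rcases hE with ⟨-, -, he⟩ | ⟨rfl, he, hl⟩
  · cases he
  · refine ⟨ρ, (leaf.inj he).symm, ?_⟩
    have hlin := linear_lhs ρ
    have hm := meets_lhs_of_isLeaf (ρ := ρ)
    rw [hl] at hlin hm ⊢
    exact parsed_node hlin hm hc (fun i hi => parsed_of_big_front hi (h₁ i hi)) h₂

/-! ### The nondeleting transducer -/

/-- This makes `back` nondeleting. If `ℓ` were a leaf and `r` ground, the pattern would still
contain the state of `ℓ`; ε-freeness excludes this. -/
theorem var_output_lhs (hM : M.EpsFree) (ρ : M.Rule) :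
    (output ρ (some ρ) ρ.1.1).var = ρ.1.2.2.var := by
  ext x
  rw [mem_var_output (linear_lhs ρ)]
  · exact ⟨And.right, fun h => ⟨M.var_subset _ _ _ ρ.2 h, h⟩⟩
  · by_cases hr : ρ.1.2.2.IsLeaf
    · exact Or.inl (meets_lhs_of_isLeaf hr)
    · exact Or.inr ⟨hM _ _ _ ρ.2, hr⟩

/-- The nondeleting transducer, which replaces a marked left-hand side by the right-hand side. -/
noncomputable def back (M : Transducer A B) (hM : M.EpsFree) :
    Transducer (prunedAlphabet A M.Rule) B where
  State := M.State
  initial := Set.univ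
  -- Every rule is available in every state: after `front` erases a rule whose right-hand side is a
  -- state, the next tag belongs to a state that `back` cannot know. The erased rules themselves are
  -- left out.
  rules := (fun x : M.Rule × M.State => (output x.1 (some x.1) x.1.1.1, x.2, x.1.1.2.2)) ''
    {x | ¬ x.1.1.2.2.IsLeaf}
  rules_finite := (Set.toFinite _).image _
  linear_left := by
    rintro _ _ _ ⟨⟨ρ, q'⟩, -, h⟩
    obtain ⟨rfl, -, -⟩ := Prod.mk.injEq .. ▸ Prod.mk.injEq .. ▸ h
    exact linear_output (linear_lhs ρ)
  linear_right := by
    rintro _ _ _ ⟨⟨ρ, q'⟩, -, h⟩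
    obtain ⟨-, -, rfl⟩ := Prod.mk.injEq .. ▸ Prod.mk.injEq .. ▸ h
    exact M.linear_right _ _ _ ρ.2
  var_subset := by
    rintro _ _ _ ⟨⟨ρ, q'⟩, -, h⟩
    obtain ⟨rfl, -, rfl⟩ := Prod.mk.injEq .. ▸ Prod.mk.injEq .. ▸ h
    exact (var_output_lhs hM ρ).ge
  lookahead _ := Set.univ
  lookahead_regular _ := isRegular_univ

theorem mem_rules_back {hM : M.EpsFree} {l : RTree (prunedAlphabet A M.Rule) M.State}
    {q : M.State} {r : RTree B M.State} : (l, q, r) ∈ (M.back hM).rules ↔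
      ∃ ρ : M.Rule, ¬ ρ.1.2.2.IsLeaf ∧ l = output ρ (some ρ) ρ.1.1 ∧ r = ρ.1.2.2 := by
  constructor
  · rintro ⟨⟨ρ, q'⟩, h, he⟩
    obtain ⟨he₁, he₂⟩ := Prod.mk.inj he
    exact ⟨ρ, h, he₁.symm, (Prod.mk.inj he₂).2.symm⟩
  · rintro ⟨ρ, h, rfl, rfl⟩
    exact ⟨(ρ, q), h, rfl⟩

theorem noLookahead_back (hM : M.EpsFree) : (M.back hM).NoLookahead := fun _ => rfl

theorem output_lhs_eq (hM : M.EpsFree) {ρ : M.Rule} (hr : ¬ ρ.1.2.2.IsLeaf) :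
    ∃ (a : A.Symbol) (ss : Fin (A.rk a) → RTree A M.State), output ρ (some ρ) ρ.1.1 =
      prunedNode ρ (some ρ) ss fun i => output ρ none (ss i) := by
  have hl := hM _ _ _ ρ.2
  generalize ρ.1.1 = l at hl
  cases l with
  | leaf p => exact (hl ⟨p, rfl⟩).elim
  | node a ss =>
    refine ⟨a, ss, ?_⟩
    simp only [output_of_not_isLeaf hr, pattern]

theorem epsFree_back (hM : M.EpsFree) : (M.back hM).EpsFree := by
  intro l q r h
  obtain ⟨ρ, hr, rfl, -⟩ := mem_rules_back.1 h
  obtain ⟨a, ss, he⟩ := output_lhs_eq hM hr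
  rw [he]
  rintro ⟨_, h⟩
  cases h

theorem strict_back (hM : M.EpsFree) : (M.back hM).Strict := by
  intro l q r h
  obtain ⟨ρ, hr, -, rfl⟩ := mem_rules_back.1 h
  exact hr

theorem nondeleting_back (hM : M.EpsFree) : (M.back hM).Nondeleting := by
  intro l q r h
  obtain ⟨ρ, hr, rfl, rfl⟩ := mem_rules_back.1 h
  exact (var_output_lhs hM ρ).symm

theorem big_back_iff {hM : M.EpsFree} {q : M.State} {g : GTree (prunedAlphabet A M.Rule)}
    {u : GTree B} : (M.back hM).Big q g u ↔ ∃ (ρ : M.Rule)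
      (γ : M.State → GTree (prunedAlphabet A M.Rule)) (η : M.State → GTree B),
      ¬ ρ.1.2.2.IsLeaf ∧ g = (output ρ (some ρ) ρ.1.1).subst γ ∧ u = ρ.1.2.2.subst η ∧
      ∀ p ∈ ρ.1.2.2.var, (M.back hM).Big p (γ p) (η p) := by
  constructor
  · rintro ⟨l, _, r, γ, η, hr, h₁, -⟩
    obtain ⟨ρ, hρ, rfl, rfl⟩ := mem_rules_back.1 hr
    exact ⟨ρ, γ, η, hρ, rfl, rfl, h₁⟩
  · rintro ⟨ρ, γ, η, hρ, rfl, rfl, h⟩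
    exact Big.mk (M := M.back hM) _ q _ γ η (mem_rules_back.2 ⟨ρ, hρ, rfl, rfl⟩) h
      fun _ _ _ => Set.mem_univ _

/-! ### The decomposition -/

theorem big_front_lhs (hM : M.EpsFree) {ρ : M.Rule} {st : M.FrontState} {θ : M.State → GTree A}
    {γ : M.State → GTree (prunedAlphabet A M.Rule)}
    (hst : (st.2.2 : RTree A M.State) = leaf ρ.1.2.1)
    (h₁ : ∀ p ∈ ρ.1.2.2.var, ∀ k ρ', M.front.Big (k, ρ', ⟨leaf p, leaf_mem_patternTerms p⟩)
      (θ p) (γ p))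
    (h₂ : ∀ p ∈ ρ.1.1.var, p ∉ ρ.1.2.2.var → θ p ∈ M.lookahead p) :
    M.front.Big st (ρ.1.1.subst θ) ((output ρ (some ρ) ρ.1.1).subst γ) := by
  have hm := meets_lhs_of_isLeaf (ρ := ρ)
  have hleaf := hM _ _ _ ρ.2
  have hE : Expands st (some ρ) ρ ρ.1.1 := Or.inr ⟨rfl, hst, rfl⟩
  generalize ρ.1.1 = l at *
  cases l with
  | leaf p => exact (hleaf ⟨p, rfl⟩).elim
  | node a ss =>
    refine big_front_node hE hm (fun i k hi hmi => big_front_subst k hi hmi h₁ fun p hp => ?_) h₂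
    exact h₂ p (mem_var_node.2 ⟨i, hp⟩)

/-- The intermediate tree replaces each `ℓ` by its pruned pattern. Quantifying over all `k`, `ρ` and
`q'` is what the induction needs: the enclosing application fixes these components arbitrarily. -/
theorem Big.exists_decomposition (hM : M.EpsFree) {q : M.State} {t : GTree A} {u : GTree B}
    (h : M.Big q t u) : ∃ g,
      (∀ k ρ, M.front.Big (k, ρ, ⟨leaf q, leaf_mem_patternTerms q⟩) t g) ∧
      ∀ q', (M.back hM).Big q' g u := by
  induction h with
  | mk l q r θ η hr _ hl ih =>
    have hex : ∀ p, ∃ g, p ∈ r.var →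
        (∀ k ρ, M.front.Big (k, ρ, ⟨leaf p, leaf_mem_patternTerms p⟩) (θ p) g) ∧
        ∀ q', (M.back hM).Big q' g (η p) := by
      intro p
      by_cases hp : p ∈ r.var
      · obtain ⟨g, hg⟩ := ih p hp
        exact ⟨g, fun _ => hg⟩
      · exact ⟨Classical.arbitrary _, fun h => (hp h).elim⟩
    choose γ hγ using hex
    let ρ : M.Rule := ⟨(l, q, r), hr⟩
    refine ⟨(output ρ (some ρ) l).subst γ, fun k ρ' => ?_, fun q' => ?_⟩
    · exact big_front_lhs (ρ := ρ) hM rfl (fun p hp => (hγ p hp).1) hl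
    · by_cases hρ : r.IsLeaf
      -- An erased application leaves the intermediate tree of `p` itself, so `back` makes no step.
      · obtain ⟨p, rfl⟩ := hρ
        rw [output_of_leaf (p := p) rfl]
        exact (hγ p (by simp)).2 q'
      · exact big_back_iff.2 ⟨ρ, γ, η, hρ, rfl, rfl, fun p hp => (hγ p hp).2 p⟩

/-- The two derivations are not synchronous, since erased applications are invisible to `back`;
hence the induction on the size of the input. -/
theorem Big.of_decomposition {hM : M.EpsFree} {q q' : M.State} {t : GTree A}
    {g : GTree (prunedAlphabet A M.Rule)} {u : GTree B}
    {k : Option (Σ a : A.Symbol, Fin (A.rk a))} {ρ' : M.Rule} {hq : leaf q ∈ M.patternTerms}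
    (h : M.front.Big (k, ρ', ⟨leaf q, hq⟩) t g) (h' : (M.back hM).Big q' g u) :
    M.Big q t u := by
  induction hn : t.size using Nat.strong_induction_on generalizing q q' t g u k ρ' with
  | _ n ih =>
    obtain ⟨ρ, rfl, θ, γ, rfl, hg, h₁, h₂⟩ := exists_rule_of_big_front h
    have hlt : ∀ p ∈ ρ.1.2.2.var, (θ p).size < n := by
      intro p hp
      have h₃ : ρ.1.1.size + (θ p).size ≤ n :=
        (size_le_size_subst (M.var_subset _ _ _ ρ.2 hp) θ).trans_eq hn
      have h₄ : 0 < ρ.1.1.size := size_pos_of_not_isLeaf (hM _ _ _ ρ.2)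
      omega
    by_cases hr : ρ.1.2.2.IsLeaf
    · obtain ⟨p, hp⟩ := hr
      have hpv := (mem_var_rhs_of_leaf hp).2 rfl
      obtain ⟨k', ρ'', hb⟩ := h₁ p (M.var_subset _ _ _ ρ.2 hpv) hpv
      rw [output_of_leaf hp, RTree.subst] at hg
      subst hg
      -- Only the front run advances; `h'` is reused with its state `q'`, which need not be `p`.
      have hu := ih _ (hlt p hpv) hb h' rfl
      have key := Big.mk ρ.1.1 ρ.1.2.1 ρ.1.2.2 θ (fun _ => u) ρ.2 ?_ h₂
      · rwa [hp, RTree.subst] at key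
      · intro p' hp'
        rwa [← (mem_var_rhs_of_leaf hp).1 hp']
    · obtain ⟨ρ₂, γ₂, η, hr₂, hg₂, rfl, h₃⟩ := big_back_iff.1 h'
      -- Both patterns have the same root symbol, whose tag is the rule.
      have hρ : ρ = ρ₂ := by
        obtain ⟨a, ss, he⟩ := output_lhs_eq hM hr
        obtain ⟨a₂, ss₂, he₂⟩ := output_lhs_eq hM hr₂
        rw [hg, he, he₂, subst_prunedNode, subst_prunedNode] at hg₂
        exact Option.some.inj (Prod.mk.inj (node.inj hg₂).1).1
      subst hρ
      -- Equal instances of one pattern agree on its variables, which are those of `r`.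
      have heq := eqOn_var_of_subst_eq (hg.symm.trans hg₂)
      rw [var_output_lhs hM] at heq
      refine Big.mk ρ.1.1 ρ.1.2.1 ρ.1.2.2 θ η ρ.2 (fun p hp => ?_) h₂
      obtain ⟨k', ρ'', hb⟩ := h₁ p (M.var_subset _ _ _ ρ.2 hp) hp
      rw [heq p hp] at hb
      exact ih _ (hlt p hp) hb (h₃ p hp) rfl

theorem transformation_eq_comp (hM : M.EpsFree) :
    M.transformation = M.front.transformation.comp (M.back hM).transformation := by
  ext ⟨t, u⟩
  rw [SetRel.mem_comp, mem_transformation_iff hM]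
  simp only [mem_transformation_iff topDown_front.epsFree,
    mem_transformation_iff (epsFree_back hM)]
  constructor
  · rintro ⟨q, hq, h⟩
    obtain ⟨g, h₁, h₂⟩ := h.exists_decomposition hM
    -- An initial state of `front` must carry some rule, though a leaf state ignores it; the
    -- derivation supplies one.
    obtain ⟨ρ⟩ : Nonempty M.Rule := by
      cases h with
      | mk l _ r _ _ hr => exact ⟨⟨_, hr⟩⟩
    exact ⟨g, ⟨(none, ρ, ⟨leaf q, leaf_mem_patternTerms q⟩), ⟨q, hq, rfl⟩, h₁ none ρ⟩,
      ⟨q, Set.mem_univ _, h₂ q⟩⟩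
  · rintro ⟨g, ⟨⟨k, ρ, s, hs⟩, ⟨q, hq, rfl⟩, h₁⟩, ⟨q', -, h₂⟩⟩
    exact ⟨q, hq, Big.of_decomposition h₁ h₂⟩

end Transducer
end XTop

theorem mainTheorem9 :
    (∀ A B : XTop.RankedAlphabet.{u},
      XTop.efreeLXTR A B ⊆
        XTop.TransClass.seq XTop.delabelingLTR XTop.efreeStrictNondeletingLXT A B) ∧
    (∀ A B : XTop.RankedAlphabet.{u},
      XTop.efreeStrictLXTR A B ⊆
        XTop.TransClass.seq XTop.strictDelabelingLTR XTop.efreeStrictNondeletingLXT A B) := by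
  refine ⟨?_, ?_⟩
  · rintro A B _ ⟨M, hM, rfl⟩
    exact ⟨_, _, ⟨M.front, M.topDown_front, M.delabeling_front, rfl⟩, _,
      ⟨M.back hM, M.noLookahead_back hM, M.epsFree_back hM, M.strict_back hM,
        M.nondeleting_back hM, rfl⟩, M.transformation_eq_comp hM⟩
  · rintro A B _ ⟨M, hM, hs, rfl⟩
    exact ⟨_, _, ⟨M.front, M.topDown_front, hs.front, M.delabeling_front, rfl⟩, _,
      ⟨M.back hM, M.noLookahead_back hM, M.epsFree_back hM, M.strict_back hM,
        M.nondeleting_back hM, rfl⟩, M.transformation_eq_comp hM⟩
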